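/- **Setting.** Let $d,N\ge 1$ be integers, $p\in(1,\infty)$, $1/p+1/q=1$, and let $D\subset\mathbb R^d$ be bounded, with $\|u\|\le M$ for all $u\in D$ ($\|\cdot\|$ is the Euclidean norm; $|||\cdot|||$ denotes operator norms). Let $\mathcal I\subset D^{\mathbb Z_-}$ be a set of inputs $z=(z_t)_{t\le 0}$. Let $\sigma_2:\mathbb R\to\mathbb R$ be Lipschitz with constant $L_{\sigma_2}$. Write $\mathcal X=\mathbb R\times\ell^p\times\mathbb R^d\times\mathbb R$, $\mathcal X^N=\mathbb R\times\mathbb R^N\times\mathbb R^d\times\mathbb R$, with points $(w,a,c,b)$, and $a\cdot x=\sum_i a_ix_i$. **Target.** Let $H:\mathcal I\to\mathbb R$ be a recurrent Barron functional with linear state equation: there are a Borel probability measure $\mu$ on $\mathcal X$, $B\in\ell^q$ and bounded linear maps $A:\ell^q\to\ell^q$, $C:\mathbb R^d\to\ell^q$ such that for each $z\in\mathcal I$ the system $x_t=Ax_{t-1}+Cz_t+B$ ($t\le 0$) has a unique solution $(x_t(z))_{t\le 0}$ bounded in $\ell^q$, $I_{\mu,p}=\int|w|(\|a\|_p+\|c\|+|b|)\,d\mu<\infty$,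 and $$H(z)=\int_{\mathcal X} w\,\sigma_2\big(a\cdot x_{-1}(z)+c\cdot z_0+b\big)\,\mu(dw,da,dc,db),\qquad z\in\mathcal I .$$ Assume $|||A|||<1$ and $I^{(2)}_{\mu,p}=\big(\int w^2(\|a\|_p^2+\|c\|^2+|b|^2+1)\,d\mu\big)^{1/2}<\infty$, and let $\lambda\in(|||A|||,1)$. **ESN–ELM.** Let $T=\lceil N/d\rceil$ and let $A^{E}\in\mathbb R^{N\times N}$, $C^{E}\in\mathbb R^{N\times d}$, $B^{E}\in\mathbb R^N$ be (a realization of) the parameters of an echo state network with $|||A^{E}|||<1$ and such that the matrix $K\in\mathbb R^{N\times N}$ formed by the first $N$ columns of $(C^{E}\,|\,A^{E}C^{E}\,|\cdots|\,(A^{E})^{T-1}C^{E})$ is invertible. Let $\Lambda\in\mathbb R^{N\times N}$ be diagonal with $\Lambda_{d(k-1)+j,\,d(k-1)+j}=\lambda^{k-1}$ ($k\ge1$, $1\le j\le d$). For $a\in\ell^p$ let $\pi\bar{\mathcal L}(a)\in\mathbb R^N$ have the entries $[\pi\bar{\mathcal L}(a)]_{d(k-1)+j}=\big[((\lambda^{-1}A)^{k-1}C)^*a\big]_j$,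 put $v(a)=K^{-\top}\Lambda\,\pi\bar{\mathcal L}(a)$, and let $\mu_{A,B,C}$ be the push-forward of $\mu$ under $$(w,a,c,b)\mapsto\Big(w,\;v(a),\;c,\;-v(a)\cdot\sum_{k=1}^{T}(A^{E})^{k-1}B^{E}+a\cdot\sum_{k=0}^\infty A^kB+b\Big)\in\mathcal X^N .$$ Let $(w^{(i)},a^{(i)},c^{(i)},b_i)$, $i=1,\dots,N$, be i.i.d. random elements of $\mathcal X^N$ with law $\nu$, and suppose that $\mu_{A,B,C}\ll\nu$ and that $d\mu_{A,B,C}/d\nu$ is ($\nu$-essentially) bounded. **Conclusion.** For every $z\in\mathcal I$ the network equation $x^{E}_t=A^{E}x^{E}_{t-1}+C^{E}z_t+B^{E}$ ($t\le0$) has a unique bounded solution, and there is a measurable $f:(\mathcal X^N)^N\to\mathbb R^N$ (independent of $z$) such that, with $W=f\big((w^{(i)},a^{(i)},c^{(i)},b_i)_{i=1,\dots,N}\big)$ and $$\widehat H(z)=\sum_{i=1}^N W_i\,\sigma_2\big(a^{(i)}\cdot x^{E}_{-1}(z)+c^{(i)}\cdot z_0+b_i\big),$$ one has for all $z\in\mathcal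 I$ $$\mathbb E\big[|H(z)-\widehat H(z)|^2\big]^{1/2}\le C_{H,\mathrm{ESN}}\Big[\lambda^{N/d}+|||A^{E}|||^{T}+\frac1{N^{1/2}}\Big\|\frac{d\mu_{A,B,C}}{d\nu}\Big\|_\infty^{1/2}\Big],$$ where $$C_{H,\mathrm{ESN}}=\tilde c_1\max\Big(\frac{|||C|||}{(1-|||\lambda^{-1}A|||^p)^{1/p}},\frac{\|B\|_q}{1-|||A|||},1\Big)\max\big(I_{\mu,p},I^{(2)}_{\mu,p}\big)\Big(1+\frac{|||C^{E}|||+\|B^{E}\|}{1-|||A^{E}|||}\,|||K^{-\top}\Lambda|||\Big)$$ and $\tilde c_1$ depends only on $d,\sigma_2,p,M,\lambda$, namely $$\tilde c_1=8^{1/2}\max(L_{\sigma_2},|\sigma_2(0)|,1)\,\max(1,d^{\frac12-\frac1p})\,d^{\frac1{2p}}\,\max(1,d^{\frac1q-\frac12})\,(1-\lambda)^{-1}(1-\lambda^q)^{-1/q}\lambda^{-1}\max(M,1)^2 .$$ -/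

import Mathlib

open MeasureTheory ProbabilityTheory
open scoped ENNReal NNReal Matrix.Norms.L2Operator

noncomputable section

/-- The space `ℓ^p` of real sequences, with its usual norm. -/
abbrev SeqSpace (p : ℝ≥0∞) : Type := lp (fun _ : ℕ => ℝ) p

/-- `ℓ^p` carries its Borel σ-algebra. -/
instance instMeasurableSpaceSeqSpace (p : ℝ≥0∞) [Fact (1 ≤ p)] : MeasurableSpace (SeqSpace p) :=
  borel _

instance instBorelSpaceSeqSpace (p : ℝ≥0∞) [Fact (1 ≤ p)] : BorelSpace (SeqSpace p) := ⟨rfl⟩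

/-- `ℝ^n` with the Euclidean norm. -/
abbrev Vec (n : ℕ) : Type := EuclideanSpace ℝ (Fin n)

/-- The parameter space `𝒳 = ℝ × ℓ^p × ℝ^d × ℝ`, with points `(w, a, c, b)`. -/
abbrev ParamSpace (p : ℝ≥0∞) (d : ℕ) : Type := ℝ × SeqSpace p × Vec d × ℝ

/-- The parameter space `𝒳^N = ℝ × ℝ^N × ℝ^d × ℝ`, with points `(w, a, c, b)`. -/
abbrev FinParamSpace (N d : ℕ) : Type := ℝ × Vec N × Vec d × ℝ

/-- Semi-infinite inputs `(z_t)_{t ≤ 0}` in `ℝ^d`. Time is reversed: `z n` stands for `z_{-n}`.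
The same convention is used for sequences of states. -/
abbrev InputSeq (d : ℕ) : Type := ℕ → Vec d

/-- The pairing `a · x = ∑ i, a_i x_i` of two sequences. -/
def seqDot {p q : ℝ≥0∞} (a : SeqSpace p) (x : SeqSpace q) : ℝ := ∑' i, a i * x i

/-- `x ∈ ℓ^∞_-(ℓ^q)` solves `x_t = σ₁(A x_{t-1} + C z_t + B)`, `t ≤ 0`, where `σ₁` acts
componentwise. -/
structure IsSeqState (σ₁ : ℝ → ℝ) {q : ℝ≥0∞} [Fact (1 ≤ q)] {d : ℕ}
    (A : SeqSpace q →ₗ[ℝ] SeqSpace q) (B : SeqSpace q) (C : Vec d →ₗ[ℝ] SeqSpace q)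
    (z : InputSeq d) (x : ℕ → SeqSpace q) : Prop where
  bounded : ∃ R : ℝ, ∀ n, ‖x n‖ ≤ R
  step : ∀ n i, x n i = σ₁ ((A (x (n + 1)) + C (z n) + B) i)

/-- `I_{μ,p} = ∫ |w| (‖a‖_p + ‖c‖ + |b|) dμ`. -/
def barronMoment {p : ℝ≥0∞} [Fact (1 ≤ p)] {d : ℕ} (μ : Measure (ParamSpace p d)) : ℝ≥0∞ :=
  ∫⁻ θ, ‖θ.1‖ₑ * (‖θ.2.1‖ₑ + ‖θ.2.2.1‖ₑ + ‖θ.2.2.2‖ₑ) ∂μ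

/-- `I_{μ,p}^{(2)} = (∫ w² (‖a‖_p² + ‖c‖² + |b|² + 1) dμ)^{1/2}`. -/
def barronMoment₂ {p : ℝ≥0∞} [Fact (1 ≤ p)] {d : ℕ} (μ : Measure (ParamSpace p d)) : ℝ≥0∞ :=
  (∫⁻ θ, ‖θ.1‖ₑ ^ 2 * (‖θ.2.1‖ₑ ^ 2 + ‖θ.2.2.1‖ₑ ^ 2 + ‖θ.2.2.2‖ₑ ^ 2 + 1) ∂μ) ^ (1 / 2 : ℝ)

/-- The functional `H`, on the set `I` of inputs, is a recurrent (generalized) Barron functional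
with the realization `(μ, A, B, C)`. A functional belongs to the class `𝒞` exactly when such a
quadruple exists. -/
structure IsBarronRealization (σ₁ σ₂ : ℝ → ℝ) {p q : ℝ≥0∞} [Fact (1 ≤ p)] [Fact (1 ≤ q)] {d : ℕ}
    (I : Set (InputSeq d)) (H : InputSeq d → ℝ) (μ : Measure (ParamSpace p d))
    (A : SeqSpace q →ₗ[ℝ] SeqSpace q) (B : SeqSpace q) (C : Vec d →ₗ[ℝ] SeqSpace q) : Prop where
  isProbabilityMeasure : IsProbabilityMeasure μ
  existsUnique_state : ∀ z ∈ I, ∃! x : ℕ → SeqSpace q, IsSeqState σ₁ A B C z x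
  moment_lt_top : barronMoment μ < ∞
  repr : ∀ z ∈ I, ∀ x : ℕ → SeqSpace q, IsSeqState σ₁ A B C z x →
    H z = ∫ θ, θ.1 * σ₂ (seqDot θ.2.1 (x 1) + inner ℝ θ.2.2.1 (z 0) + θ.2.2.2) ∂μ

/-- Parameters of an echo state network with `N` neurons and inputs in `ℝ^d`. -/
structure ESN (N d : ℕ) where
  A : Matrix (Fin N) (Fin N) ℝ
  B : Vec N
  C : Matrix (Fin N) (Fin d) ℝ

/-- `x ∈ ℓ^∞_-(ℝ^N)` solves `x_t = σ₁(A^ESN x_{t-1} + C^ESN z_t + B^ESN)`, `t ≤ 0`, where `σ₁`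
acts componentwise. -/
structure ESN.IsState {N d : ℕ} (E : ESN N d) (σ₁ : ℝ → ℝ) (z : InputSeq d) (x : ℕ → Vec N) :
    Prop where
  bounded : ∃ R : ℝ, ∀ n, ‖x n‖ ≤ R
  step : ∀ n i, x n i = σ₁ ((E.A.toEuclideanLin (x (n + 1)) + E.C.toEuclideanLin (z n) + E.B) i)

/-- `T = ⌈N / d⌉`. -/
def horizon (N d : ℕ) : ℕ := ⌈(N : ℝ) / d⌉₊

/-- The Kalman controllability matrix: the first `N` columns of
`(C | A C | ⋯ | A^{T-1} C)` with `A = A^ESN`, `C = C^ESN`. With columns numbered from `0`, column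
`d k + j` (`0 ≤ j < d`) is column `j` of `A^k C`. -/
def ESN.K {N d : ℕ} [NeZero d] (E : ESN N d) : Matrix (Fin N) (Fin N) ℝ :=
  Matrix.of fun r i => (E.A ^ ((i : ℕ) / d) * E.C) r (Fin.ofNat d i)

/-- The diagonal matrix `Λ`, with entry `lam ^ k` at position `d k + j` (`0 ≤ j < d`, counting
from `0`). -/
def scalingMatrix (N d : ℕ) (lam : ℝ) : Matrix (Fin N) (Fin N) ℝ :=
  Matrix.diagonal fun i => lam ^ ((i : ℕ) / d)

/-- The matrix `K^{-⊤} Λ`. -/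
def ESN.KinvTΛ {N d : ℕ} [NeZero d] (E : ESN N d) (lam : ℝ) : Matrix (Fin N) (Fin N) ℝ :=
  E.K⁻¹.transpose * scalingMatrix N d lam

/-- The sequence `L̄(a)`: counting from `0`, its entry `d k + j` is
`[((lam⁻¹ A)^k C)^* a]_j = a · ((lam⁻¹ A)^k C e_j)`, with `e_j` the standard basis of `ℝ^d`. -/
def Lbar {p q : ℝ≥0∞} [Fact (1 ≤ p)] [Fact (1 ≤ q)] {d : ℕ} [NeZero d]
    (A : SeqSpace q →L[ℝ] SeqSpace q) (C : Vec d →L[ℝ] SeqSpace q) (lam : ℝ)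
    (a : SeqSpace p) (i : ℕ) : ℝ :=
  seqDot a (((lam⁻¹ • A) ^ (i / d)) (C (EuclideanSpace.single (Fin.ofNat d i) 1)))

/-- The map `ψ_{A,B,C} : 𝒳 → 𝒳^N`. -/
def psi {p q : ℝ≥0∞} [Fact (1 ≤ p)] [Fact (1 ≤ q)] {N d : ℕ} [NeZero d] (E : ESN N d)
    (A : SeqSpace q →L[ℝ] SeqSpace q) (B : SeqSpace q) (C : Vec d →L[ℝ] SeqSpace q) (lam : ℝ)
    (θ : ParamSpace p d) : FinParamSpace N d :=
  let v : Vec N :=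
    (E.KinvTΛ lam).toEuclideanLin (WithLp.toLp 2 fun i : Fin N => Lbar A C lam θ.2.1 i)
  (θ.1, v, θ.2.2.1,
    -inner ℝ v (∑ k ∈ Finset.range (horizon N d), (E.A ^ k).toEuclideanLin E.B)
      + seqDot θ.2.1 (∑' k : ℕ, (A ^ k) B) + θ.2.2.2)

/-- The push-forward `μ_{A,B,C} = μ ∘ ψ_{A,B,C}⁻¹`. -/
def muABC {p q : ℝ≥0∞} [Fact (1 ≤ p)] [Fact (1 ≤ q)] {N d : ℕ} [NeZero d] (E : ESN N d)
    (μ : Measure (ParamSpace p d)) (A : SeqSpace q →L[ℝ] SeqSpace q) (B : SeqSpace q)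
    (C : Vec d →L[ℝ] SeqSpace q) (lam : ℝ) : Measure (FinParamSpace N d) :=
  μ.map (psi E A B C lam)

/-- The output `∑ i, W_i σ₂(a⁽ⁱ⁾ · x + c⁽ⁱ⁾ · z₀ + b_i)` of the extreme learning machine with
weights `θ i = (w⁽ⁱ⁾, a⁽ⁱ⁾, c⁽ⁱ⁾, b_i)` (whose first entry is not used) and readout `W`; here
`x` is the state at time `-1`. -/
def elmOutput (σ₂ : ℝ → ℝ) {N d : ℕ} (W : Fin N → ℝ) (θ : Fin N → FinParamSpace N d)
    (x : Vec N) (z₀ : Vec d) : ℝ :=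
  ∑ i, W i * σ₂ (inner ℝ (θ i).2.1 x + inner ℝ (θ i).2.2.1 z₀ + (θ i).2.2.2)

/-- The constant `c̃₁`; `L` is a Lipschitz constant of `σ₂`, `s₀ = σ₂ 0`, and `M` bounds the
norm on the input set. -/
def cTilde (d : ℕ) (L s₀ p q M lam : ℝ) : ℝ :=
  (8 : ℝ) ^ (1 / 2 : ℝ) * max (max L |s₀|) 1 * max 1 ((d : ℝ) ^ (1 / 2 - 1 / p))
    * (d : ℝ) ^ (1 / (2 * p)) * max 1 ((d : ℝ) ^ (1 / q - 1 / 2))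
    * (1 - lam)⁻¹ * (1 - lam ^ q) ^ (-(1 / q)) * lam⁻¹ * max M 1 ^ 2

/-- The constant `C_{H,ESN}`. -/
def constHESN {p q : ℝ≥0∞} [Fact (1 ≤ p)] [Fact (1 ≤ q)] {N d : ℕ} [NeZero d] (E : ESN N d)
    (μ : Measure (ParamSpace p d)) (A : SeqSpace q →L[ℝ] SeqSpace q) (B : SeqSpace q)
    (C : Vec d →L[ℝ] SeqSpace q) (L s₀ M lam : ℝ) : ℝ :=
  cTilde d L s₀ p.toReal q.toReal M lam
    * max (max (‖C‖ / (1 - ‖lam⁻¹ • A‖ ^ p.toReal) ^ (1 / p.toReal)) (‖B‖ / (1 - ‖A‖))) 1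
    * max (barronMoment μ).toReal (barronMoment₂ μ).toReal
    * (1 + (‖E.C‖ + ‖E.B‖) / (1 - ‖E.A‖) * ‖E.KinvTΛ lam‖)

end

/-
The state at time `-1` of a linear system is `∑_{k<T} A^k B`, plus its response to the `N` most
recent scalar past inputs, plus a remainder of order `‖A‖^(T-1)`. Since `K` is invertible, the
response of the network to those inputs is a bijective image of them, and `v(a)` is the functional
of the network state that reproduces `a · (response of (A, C))`. Hence the arguments of `σ₂` for
the target and for the network differ by at most `G η ‖a‖`, where `G` (`argScale`) bounds the
arguments themselves and `η` (`transferError`) collects the two remainders. Importance sampling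
with the density `dμ_{A,B,C} / dν` then gives an unbiased estimator of the integral against
`μ_{A,B,C}`, and bias plus standard deviation are at most `W (η + s (√7 + η))`, where `W` is
`outputScale` and `s` is `samplingRate`.

Comparing the norms on `ℓ^q` and `ℝ^d` block by block costs a factor `T ^ max 0 (1/2 - 1/p)` in
`η` which the asserted constant does not contain. It is absorbed by a dichotomy: let `δ` be the
asserted rate times `1 + transferGain` and the power of `d` in the constant. If `1 ≤ δ`, the
asserted bound exceeds `√7 W`, which bounds the target, and the readout `0` works. If `δ ≤ 1`,
then `transferGain · N ^ (-1/2) ≤ 1`, whence `1 / (1 - ‖A^E‖) ≤ √N`, and for such `‖A^E‖` the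
geometric decay of `‖A^E‖ ^ (T-1)` compensates the power of `T`.
-/

section LinearSystem

variable {F G : Type*} [NormedAddCommGroup F] [NormedSpace ℝ F]
  [NormedAddCommGroup G] [NormedSpace ℝ G]

theorem norm_pow_apply_le (A : F →L[ℝ] F) (k : ℕ) (y : F) : ‖(A ^ k) y‖ ≤ ‖A‖ ^ k * ‖y‖ := by
  induction k with
  | zero => simp
  | succ k ih =>
    calc ‖(A ^ (k + 1)) y‖ = ‖A ((A ^ k) y)‖ := by rw [pow_succ', mul_apply_eq_comp]
      _ ≤ ‖A‖ * (‖A‖ ^ k * ‖y‖) := A.le_opNorm_of_le ih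
      _ = ‖A‖ ^ (k + 1) * ‖y‖ := by ring

theorem tsum_pow_apply_eq_apply_add [CompleteSpace F] {A : F →L[ℝ] F} (hA : ‖A‖ < 1) (B : F) :
    ∑' k : ℕ, (A ^ k) B = A (∑' k : ℕ, (A ^ k) B) + B := by
  have hsum : Summable fun k : ℕ => (A ^ k) B :=
    .of_norm_bounded ((summable_geometric_of_lt_one (norm_nonneg _) hA).mul_right ‖B‖)
      fun k => norm_pow_apply_le A k B
  rw [A.map_tsum hsum]
  conv_lhs => rw [hsum.tsum_eq_zero_add, add_comm]
  simp only [pow_succ', mul_apply_eq_comp, pow_zero, one_apply_eq_self]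

/-- `x` is a bounded solution of the linear state equation `x_t = A x_{t-1} + u_t`, `t ≤ 0`, with
time reversed as in `InputSeq`. -/
structure IsBoundedState (A : F →L[ℝ] F) (u x : ℕ → F) : Prop where
  bounded : ∃ R : ℝ, ∀ n, ‖x n‖ ≤ R
  step : ∀ n, x n = A (x (n + 1)) + u n

namespace IsBoundedState

variable {A : F →L[ℝ] F} {u x y : ℕ → F}

theorem norm_le (h : IsBoundedState A u x) (hA : ‖A‖ < 1) {U : ℝ} (hu : ∀ n, ‖u n‖ ≤ U) (n : ℕ) :
    ‖x n‖ ≤ U / (1 - ‖A‖) := by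
  obtain ⟨R, hR⟩ := h.bounded
  have hbdd : BddAbove (Set.range fun n => ‖x n‖) := ⟨R, Set.forall_mem_range.2 hR⟩
  have hsup : (⨆ n, ‖x n‖) ≤ ‖A‖ * (⨆ n, ‖x n‖) + U := by
    refine ciSup_le fun m => ?_
    rw [h.step m]
    exact norm_add_le_of_le (A.le_opNorm_of_le (le_ciSup hbdd (m + 1))) (hu m)
  refine (le_ciSup hbdd n).trans ?_
  rw [le_div_iff₀ (by linarith)]
  linarith

theorem unique (hx : IsBoundedState A u x) (hy : IsBoundedState A u y) (hA : ‖A‖ < 1) :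
    x = y := by
  obtain ⟨R, hR⟩ := hx.bounded
  obtain ⟨R', hR'⟩ := hy.bounded
  have hsub : IsBoundedState A (fun _ => 0) (fun n => x n - y n) :=
    ⟨⟨R + R', fun n => norm_sub_le_of_le (hR n) (hR' n)⟩,
      fun n => by rw [hx.step n, hy.step n, map_sub]; abel⟩
  funext n
  simpa [sub_eq_zero] using hsub.norm_le hA (U := 0) (by simp) n

theorem eq_sum_add (h : IsBoundedState A u x) (n T : ℕ) :
    x n = ∑ k ∈ Finset.range T, (A ^ k) (u (n + k)) + (A ^ T) (x (n + T)) := by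
  induction T with
  | zero => simp
  | succ T ih =>
    rw [ih, Finset.sum_range_succ, h.step (n + T), map_add, pow_succ, mul_apply_eq_comp]
    abel_nf

theorem sub_fixedPoint {v : ℕ → F} {B b : F} (h : IsBoundedState A (fun n => v n + B) x)
    (hb : b = A b + B) : IsBoundedState A v (fun n => x n - b) := by
  obtain ⟨R, hR⟩ := h.bounded
  refine ⟨⟨R + ‖b‖, fun n => norm_sub_le_of_le (hR n) le_rfl⟩, fun n => ?_⟩
  calc x n - b = A (x (n + 1)) + (v n + B) - (A b + B) := by rw [← hb, ← h.step n]
    _ = A (x (n + 1) - b) + v n := by rw [map_sub]; abel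

/-- The inputs `z` enter a state only through the modified inputs `ζ`, which may differ from them
at the last of the `T + 1` unrolled steps. -/
theorem norm_sub_truncation_le {C : G →L[ℝ] F} {B : F} {z ζ : ℕ → G} {M : ℝ} {T : ℕ}
    (h : IsBoundedState A (fun n => C (z n) + B) x) (hA : ‖A‖ < 1) (hz : ∀ n, ‖z n‖ ≤ M)
    (hζ : ∀ k < T, ζ k = z (1 + k)) (hζT : ‖z (1 + T) - ζ T‖ ≤ M) :
    ‖x 1 - (∑ k ∈ Finset.range (T + 1), (A ^ k) B
        + ∑ k ∈ Finset.range (T + 1), (A ^ k) (C (ζ k)))‖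
      ≤ ‖A‖ ^ T * ((‖C‖ * M + ‖B‖) / (1 - ‖A‖)) := by
  set R := (‖C‖ * M + ‖B‖) / (1 - ‖A‖) with hR
  have hstate : ‖x (1 + T + 1)‖ ≤ R :=
    h.norm_le hA (fun n => norm_add_le_of_le (C.le_opNorm_of_le (hz n)) le_rfl) _
  have hRA : R = ‖A‖ * R + (‖C‖ * M + ‖B‖) := by
    have : 1 - ‖A‖ ≠ 0 := by linarith
    rw [hR]
    field_simp
    ring
  have hsum : ∑ k ∈ Finset.range T, (A ^ k) (C (z (1 + k)) + B)
      = ∑ k ∈ Finset.range T, (A ^ k) B + ∑ k ∈ Finset.range T, (A ^ k) (C (ζ k)) := by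
    rw [← Finset.sum_add_distrib]
    refine Finset.sum_congr rfl fun k hk => ?_
    rw [hζ k (Finset.mem_range.1 hk), map_add, add_comm]
  have hrem : x 1 - (∑ k ∈ Finset.range (T + 1), (A ^ k) B
        + ∑ k ∈ Finset.range (T + 1), (A ^ k) (C (ζ k)))
      = (A ^ T) (A (x (1 + T + 1)) + C (z (1 + T) - ζ T)) := by
    rw [h.eq_sum_add 1 T, hsum, h.step (1 + T), Finset.sum_range_succ, Finset.sum_range_succ]
    simp only [map_add, map_sub]
    abel
  rw [hrem]
  refine (norm_pow_apply_le A T _).trans ?_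
  gcongr
  calc ‖A (x (1 + T + 1)) + C (z (1 + T) - ζ T)‖ ≤ ‖A‖ * R + ‖C‖ * M :=
        norm_add_le_of_le (A.le_opNorm_of_le hstate) (C.le_opNorm_of_le hζT)
    _ ≤ R := by linarith [norm_nonneg B]

end IsBoundedState

theorem existsUnique_isBoundedState [CompleteSpace F] {A : F →L[ℝ] F} (hA : ‖A‖ < 1) {u : ℕ → F}
    {U : ℝ} (hu : ∀ n, ‖u n‖ ≤ U) : ∃! x : ℕ → F, IsBoundedState A u x := by
  have hle : ∀ n k, ‖(A ^ k) (u (n + k))‖ ≤ ‖A‖ ^ k * U := fun n k =>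
    (norm_pow_apply_le A k _).trans (by gcongr; exact hu _)
  have hgeom : Summable fun k : ℕ => ‖A‖ ^ k * U :=
    (summable_geometric_of_lt_one (norm_nonneg _) hA).mul_right U
  have hsum : ∀ n, Summable fun k => (A ^ k) (u (n + k)) := fun n => .of_norm_bounded hgeom (hle n)
  have hstate : IsBoundedState A u fun n => ∑' k, (A ^ k) (u (n + k)) := by
    refine ⟨⟨∑' k, ‖A‖ ^ k * U, fun n => tsum_of_norm_bounded hgeom.hasSum (hle n)⟩, fun n => ?_⟩
    rw [(hsum n).tsum_eq_zero_add, A.map_tsum (hsum (n + 1)), add_comm]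
    simp only [pow_succ', mul_apply_eq_comp, pow_zero, one_apply_eq_self, add_zero, add_assoc,
      add_comm 1]
  exact ⟨_, hstate, fun y hy => hy.unique hstate hA⟩

end LinearSystem

theorem sum_range_mul_divMod {F : Type*} [AddCommMonoid F] {d : ℕ} [NeZero d]
    (g : ℕ → Fin d → F) (n : ℕ) :
    ∑ i ∈ Finset.range (d * n), g (i / d) (Fin.ofNat d i) = ∑ k ∈ Finset.range n, ∑ j, g k j := by
  induction n with
  | zero => simp
  | succ n ih =>
    rw [Nat.mul_succ, Finset.sum_range_add, ih, Finset.sum_range_succ,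
      ← Fin.sum_univ_eq_sum_range (fun i => g ((d * n + i) / d) (Fin.ofNat d (d * n + i)))]
    congr 1
    refine Finset.sum_congr rfl fun j _ => ?_
    have hdiv : (d * n + (j : ℕ)) / d = n := by
      rw [Nat.mul_add_div (NeZero.pos d), Nat.div_eq_of_lt j.2, add_zero]
    have hmod : Fin.ofNat d (d * n + j) = j := by
      ext
      simp [Fin.ofNat, Nat.mod_eq_of_lt j.2]
    rw [hdiv, hmod]

theorem sum_fin_divMod {F : Type*} [AddCommMonoid F] {d N T : ℕ} [NeZero d] (hN : N ≤ d * T)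
    (g : ℕ → Fin d → F) :
    ∑ i : Fin N, g ((i : ℕ) / d) (Fin.ofNat d i)
      = ∑ k ∈ Finset.range T, ∑ j : Fin d, if d * k + j < N then g k j else 0 := by
  have hdivMod : ∀ i, d * (i / d) + ((Fin.ofNat d i : Fin d) : ℕ) = i := fun i => by
    simp [Fin.ofNat, Nat.div_add_mod]
  rw [← sum_range_mul_divMod (fun k j => if d * k + (j : ℕ) < N then g k j else 0) T,
    Fin.sum_univ_eq_sum_range (fun i => g (i / d) (Fin.ofNat d i)) N]
  simp_rw [hdivMod]
  rw [← Finset.sum_filter]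
  congr 1
  ext i
  simp only [Finset.mem_range, Finset.mem_filter]
  omega

section Horizon

variable {N d : ℕ} [NeZero d]

theorem le_mul_horizon : N ≤ d * horizon N d := by
  have hd : (0 : ℝ) < d := mod_cast NeZero.pos d
  exact_mod_cast (div_le_iff₀' hd).1 (Nat.le_ceil ((N : ℝ) / d))

theorem horizon_pos [NeZero N] : 0 < horizon N d := by
  have hd : (0 : ℝ) < d := mod_cast NeZero.pos d
  have hN : (0 : ℝ) < N := mod_cast NeZero.pos N
  exact Nat.ceil_pos.2 (by positivity)

theorem mul_horizon_sub_one_lt [NeZero N] : d * (horizon N d - 1) < N := by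
  have hd : (0 : ℝ) < d := mod_cast NeZero.pos d
  exact_mod_cast (lt_div_iff₀' hd).1 (Nat.lt_ceil.1 (Nat.sub_one_lt horizon_pos.ne'))

end Horizon

section Response

variable {F : Type*} [NormedAddCommGroup F] [NormedSpace ℝ F] {N d : ℕ}

/-- The inputs `z_{-1}, z_{-2}, …`, of which only the first `N` scalar entries are kept and the
others are replaced by `0`. -/
noncomputable def truncatedInput (N : ℕ) (z : InputSeq d) (k : ℕ) : Vec d :=
  WithLp.toLp 2 fun j => if d * k + j < N then z (1 + k) j else 0

theorem truncatedInput_eq {k T : ℕ} (hT : d * T < N) (hk : k < T) (z : InputSeq d) :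
    truncatedInput N z k = z (1 + k) := by
  ext j
  have hj : d * k + j < N := by
    have := Nat.mul_le_mul_left d (Nat.succ_le_of_lt hk)
    rw [Nat.mul_succ] at this
    have := j.2
    omega
  simp [truncatedInput, hj]

theorem norm_sub_truncatedInput_le (N : ℕ) (z : InputSeq d) (k : ℕ) :
    ‖z (1 + k) - truncatedInput N z k‖ ≤ ‖z (1 + k)‖ := by
  rw [EuclideanSpace.norm_eq, EuclideanSpace.norm_eq]
  refine Real.sqrt_le_sqrt (Finset.sum_le_sum fun j _ => ?_)
  simp only [truncatedInput, PiLp.sub_apply]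
  split_ifs
  · simp [sq_nonneg]
  · simp

variable [NeZero d]

/-- The first `N` scalar inputs before time `0`, numbered like the columns of `ESN.K`. -/
noncomputable def pastInputs (N : ℕ) (z : InputSeq d) (i : Fin N) : ℝ :=
  z (1 + (i : ℕ) / d) (Fin.ofNat d i)

/-- The contribution of `N` scalar inputs `ζ` to the state at time `-1` of the linear system
`x_t = A x_{t-1} + C z_t`, with the numbering of `pastInputs`. -/
noncomputable def response (A : F →L[ℝ] F) (C : Vec d →L[ℝ] F) (ζ : Fin N → ℝ) : F :=
  ∑ i, ζ i • (A ^ ((i : ℕ) / d)) (C (EuclideanSpace.single (Fin.ofNat d i) 1))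

theorem sum_pow_apply_truncatedInput {T : ℕ} (hN : N ≤ d * T) (A : F →L[ℝ] F)
    (C : Vec d →L[ℝ] F) (z : InputSeq d) :
    ∑ k ∈ Finset.range T, (A ^ k) (C (truncatedInput N z k))
      = response A C (pastInputs N z) := by
  simp only [response, pastInputs]
  rw [sum_fin_divMod hN fun k j => z (1 + k) j • (A ^ k) (C (EuclideanSpace.single j 1))]
  refine Finset.sum_congr rfl fun k _ => ?_
  have hbasis : truncatedInput N z k
      = ∑ j, truncatedInput N z k j • EuclideanSpace.single j (1 : ℝ) := by
    ext l
    simp [Finset.sum_apply, Pi.single_apply]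
  rw [hbasis, map_sum, map_sum]
  refine Finset.sum_congr rfl fun j _ => ?_
  rw [map_smul, map_smul]
  simp only [truncatedInput]
  split_ifs <;> simp

theorem IsBoundedState.norm_sub_response_le [NeZero N] {A : F →L[ℝ] F} {C : Vec d →L[ℝ] F} {B : F}
    {z : InputSeq d} {x : ℕ → F} (h : IsBoundedState A (fun n => C (z n) + B) x) (hA : ‖A‖ < 1)
    {M : ℝ} (hz : ∀ n, ‖z n‖ ≤ M) :
    ‖x 1 - (∑ k ∈ Finset.range (horizon N d), (A ^ k) B + response A C (pastInputs N z))‖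
      ≤ ‖A‖ ^ (horizon N d - 1) * ((‖C‖ * M + ‖B‖) / (1 - ‖A‖)) := by
  have hT : horizon N d - 1 + 1 = horizon N d := Nat.sub_add_cancel horizon_pos
  have hle := h.norm_sub_truncation_le hA hz
    (fun k hk => truncatedInput_eq (mul_horizon_sub_one_lt (N := N) (d := d)) hk z)
    ((norm_sub_truncatedInput_le N z _).trans (hz _))
  rwa [hT, sum_pow_apply_truncatedInput le_mul_horizon] at hle

theorem sum_sq_apply_pow_apply_le {T : ℕ} (hN : N ≤ d * T) (φ : F →L[ℝ] ℝ) (A : F →L[ℝ] F)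
    (C : Vec d →L[ℝ] F) :
    ∑ i : Fin N, φ ((A ^ ((i : ℕ) / d)) (C (EuclideanSpace.single (Fin.ofNat d i) 1))) ^ 2
      ≤ (‖φ‖ * ‖C‖) ^ 2 * ∑ k ∈ Finset.range T, (‖A‖ ^ k) ^ 2 := by
  rw [sum_fin_divMod hN fun k j => φ ((A ^ k) (C (EuclideanSpace.single j 1))) ^ 2,
    Finset.mul_sum]
  refine Finset.sum_le_sum fun k _ => ?_
  have hop : ‖φ ∘L (A ^ k) ∘L C‖ ≤ ‖φ‖ * ‖C‖ * ‖A‖ ^ k := by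
    refine ContinuousLinearMap.opNorm_le_bound _ (by positivity) fun u => ?_
    calc ‖φ ((A ^ k) (C u))‖ ≤ ‖φ‖ * (‖A‖ ^ k * (‖C‖ * ‖u‖)) := by
          refine φ.le_opNorm_of_le ((norm_pow_apply_le A k _).trans ?_)
          gcongr
          exact C.le_opNorm u
      _ = ‖φ‖ * ‖C‖ * ‖A‖ ^ k * ‖u‖ := by ring
  calc ∑ j : Fin d, (if d * k + j < N then φ ((A ^ k) (C (EuclideanSpace.single j 1))) ^ 2 else 0)
      ≤ ∑ j, φ ((A ^ k) (C (EuclideanSpace.single j 1))) ^ 2 :=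
        Finset.sum_le_sum fun j _ => by split_ifs; exacts [le_rfl, sq_nonneg _]
    _ = ‖φ ∘L (A ^ k) ∘L C‖ ^ 2 := by
        simp [(EuclideanSpace.basisFun (Fin d) ℝ).norm_dual (φ ∘L (A ^ k) ∘L C)]
    _ ≤ (‖φ‖ * ‖C‖) ^ 2 * (‖A‖ ^ k) ^ 2 := by
        rw [← mul_pow]
        gcongr

end Response

section Pairing

variable {p q : ℝ≥0∞} [Fact (1 ≤ p)] [Fact (1 ≤ q)] [ENNReal.HolderConjugate p q]

/-- The pairing `seqDot` as a continuous bilinear map. -/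
noncomputable def seqPairing : SeqSpace p →L[ℝ] SeqSpace q →L[ℝ] ℝ :=
  lp.dualPairing p q (fun _ => ContinuousLinearMap.mul ℝ ℝ) (K := 1) fun _ => by simp

theorem seqPairing_apply (a : SeqSpace p) (x : SeqSpace q) : seqPairing a x = seqDot a x := rfl

theorem norm_seqPairing_apply_le (a : SeqSpace p) :
    ‖(seqPairing a : SeqSpace q →L[ℝ] ℝ)‖ ≤ ‖a‖ := by
  simpa using (seqPairing (p := p) (q := q)).le_of_opNorm_le
    (lp.norm_dualPairing (fun _ => ContinuousLinearMap.mul ℝ ℝ) (K := 1) fun _ => by simp) a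

theorem abs_seqDot_le (a : SeqSpace p) (x : SeqSpace q) : |seqDot a x| ≤ ‖a‖ * ‖x‖ :=
  (seqPairing a).le_of_opNorm_le (norm_seqPairing_apply_le a) x

theorem continuous_seqDot_left (x : SeqSpace q) : Continuous fun a : SeqSpace p => seqDot a x := by
  simp only [← seqPairing_apply]
  fun_prop

end Pairing

theorem norm_toEuclideanLin_apply_le {m n : ℕ} (Q : Matrix (Fin m) (Fin n) ℝ) (x : Vec n) :
    ‖Q.toEuclideanLin x‖ ≤ ‖Q‖ * ‖x‖ :=
  Matrix.l2_opNorm_mulVec Q x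

namespace ESN

variable {N d : ℕ} (E : ESN N d)

/-- The connectivity matrix as a bounded operator. -/
noncomputable def clmA : Vec N →L[ℝ] Vec N := Matrix.toEuclideanCLM (n := Fin N) (𝕜 := ℝ) E.A

/-- The input matrix as a bounded operator. -/
noncomputable def clmC : Vec d →L[ℝ] Vec N := LinearMap.toContinuousLinearMap E.C.toEuclideanLin

theorem norm_clmA : ‖E.clmA‖ = ‖E.A‖ := Matrix.l2_opNorm_toEuclideanCLM E.A

theorem norm_clmC : ‖E.clmC‖ = ‖E.C‖ := rfl

theorem clmA_pow_apply (k : ℕ) (x : Vec N) : (E.clmA ^ k) x = (E.A ^ k).toEuclideanLin x := by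
  rw [clmA, ← map_pow]
  rfl

theorem isState_id_iff {z : InputSeq d} {x : ℕ → Vec N} :
    E.IsState id z x ↔ IsBoundedState E.clmA (fun n => E.clmC (z n) + E.B) x := by
  refine ⟨fun h => ⟨h.bounded, fun n => ?_⟩, fun h => ⟨h.bounded, fun n i => ?_⟩⟩
  · rw [← add_assoc]
    ext i
    exact h.step n i
  · rw [h.step n, ← add_assoc]
    rfl

theorem existsUnique_isState_id (hE : ‖E.A‖ < 1) {z : InputSeq d} {M : ℝ}
    (hz : ∀ n, ‖z n‖ ≤ M) : ∃! x : ℕ → Vec N, E.IsState id z x := by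
  simp only [isState_id_iff]
  exact existsUnique_isBoundedState (E.norm_clmA.trans_lt hE)
    fun n => norm_add_le_of_le (E.clmC.le_opNorm_of_le (hz n)) le_rfl

variable [NeZero d]

theorem toEuclideanLin_K_apply (ζ : Fin N → ℝ) :
    E.K.toEuclideanLin (WithLp.toLp 2 ζ) = response E.clmA E.clmC ζ := by
  have hcol : ∀ (k : ℕ) (j : Fin d) (r : Fin N),
      ((E.clmA ^ k) (E.clmC (EuclideanSpace.single j 1))) r = (E.A ^ k * E.C) r j := by
    intro k j r
    rw [clmA_pow_apply]
    change Matrix.mulVec (E.A ^ k) (Matrix.mulVec E.C (Pi.single j 1)) r = _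
    rw [Matrix.mulVec_mulVec, Matrix.mulVec_single_one]
    rfl
  ext r
  have hmulVec : (E.K.toEuclideanLin (WithLp.toLp 2 ζ)) r
      = ∑ i : Fin N, (E.A ^ ((i : ℕ) / d) * E.C) r (Fin.ofNat d i) * ζ i := rfl
  rw [hmulVec, response, WithLp.ofLp_sum, Finset.sum_apply]
  refine Finset.sum_congr rfl fun i _ => ?_
  rw [WithLp.ofLp_smul, Pi.smul_apply, hcol, smul_eq_mul, mul_comm]

theorem inner_KinvTΛ_response (hK : IsUnit E.K) (lam : ℝ) (l ζ : Fin N → ℝ) :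
    inner ℝ ((E.KinvTΛ lam).toEuclideanLin (WithLp.toLp 2 l)) (response E.clmA E.clmC ζ)
      = ∑ i : Fin N, lam ^ ((i : ℕ) / d) * l i * ζ i := by
  have hinv : E.K.transpose * E.KinvTΛ lam = scalingMatrix N d lam := by
    rw [KinvTΛ, ← Matrix.mul_assoc, ← Matrix.transpose_mul,
      Matrix.nonsing_inv_mul _ ((Matrix.isUnit_iff_isUnit_det _).1 hK), Matrix.transpose_one,
      Matrix.one_mul]
  rw [← toEuclideanLin_K_apply, EuclideanSpace.inner_eq_star_dotProduct, star_trivial]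
  simp only [Matrix.toLpLin_apply]
  rw [dotProduct_comm, Matrix.dotProduct_mulVec, ← Matrix.mulVec_transpose, Matrix.mulVec_mulVec,
    hinv]
  simp [scalingMatrix, dotProduct, Matrix.mulVec_diagonal]

theorem one_le_norm_KinvTΛ_mul_norm_C [NeZero N] (hK : IsUnit E.K) (lam : ℝ) :
    1 ≤ ‖E.KinvTΛ lam‖ * ‖E.C‖ := by
  have hinner : inner ℝ ((E.KinvTΛ lam).toEuclideanLin (EuclideanSpace.single 0 1))
      (E.clmC (EuclideanSpace.single 0 1)) = 1 := by
    simpa [response, Pi.single_apply, PiLp.toLp_single] using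
      E.inner_KinvTΛ_response hK lam (Pi.single 0 1) (Pi.single 0 1)
  rw [← hinner]
  refine (real_inner_le_norm _ _).trans (mul_le_mul ?_ ?_ (norm_nonneg _) (norm_nonneg _))
  · exact (norm_toEuclideanLin_apply_le _ _).trans_eq (by simp)
  · exact (E.clmC.le_opNorm _).trans_eq (by simp [norm_clmC])

end ESN

section Transfer

variable {p q : ℝ≥0∞} [Fact (1 ≤ p)] [Fact (1 ≤ q)] {N d : ℕ}

theorem isSeqState_id_iff {A : SeqSpace q →L[ℝ] SeqSpace q} {B : SeqSpace q}
    {C : Vec d →L[ℝ] SeqSpace q} {z : InputSeq d} {x : ℕ → SeqSpace q} :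
    IsSeqState id A.toLinearMap B C.toLinearMap z x
      ↔ IsBoundedState A (fun n => C (z n) + B) x := by
  refine ⟨fun h => ⟨h.bounded, fun n => ?_⟩, fun h => ⟨h.bounded, fun n i => ?_⟩⟩
  · rw [← add_assoc]
    ext i
    exact h.step n i
  · rw [h.step n, ← add_assoc]
    rfl

/-- The argument of `σ₂` in the target functional, at the parameter `θ`; `x` is the state at time
`-1` and `z₀` the input at time `0`. -/
noncomputable def targetArg (x : SeqSpace q) (z₀ : Vec d) (θ : ParamSpace p d) : ℝ :=
  seqDot θ.2.1 x + inner ℝ θ.2.2.1 z₀ + θ.2.2.2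

/-- The argument of `σ₂` in the extreme learning machine, at the weight `ϑ`; `y` is the state at
time `-1` and `z₀` the input at time `0`. -/
noncomputable def networkArg (y : Vec N) (z₀ : Vec d) (ϑ : FinParamSpace N d) : ℝ :=
  inner ℝ ϑ.2.1 y + inner ℝ ϑ.2.2.1 z₀ + ϑ.2.2.2

theorem measurable_networkArg (y : Vec N) (z₀ : Vec d) : Measurable (networkArg y z₀) := by
  unfold networkArg
  fun_prop

theorem measurable_targetArg [ENNReal.HolderConjugate p q] (x : SeqSpace q) (z₀ : Vec d) :
    Measurable (targetArg x z₀ : ParamSpace p d → ℝ) := by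
  have hdot := (continuous_seqDot_left (p := p) x).measurable
  unfold targetArg
  fun_prop

variable [NeZero d]

/-- The vector `v(a) = K^{-⊤} Λ π L̄(a)`. -/
noncomputable def transferVec (E : ESN N d) (A : SeqSpace q →L[ℝ] SeqSpace q)
    (C : Vec d →L[ℝ] SeqSpace q) (lam : ℝ) (a : SeqSpace p) : Vec N :=
  (E.KinvTΛ lam).toEuclideanLin (WithLp.toLp 2 fun i : Fin N => Lbar A C lam a i)

variable [ENNReal.HolderConjugate p q]

theorem continuous_transferVec (E : ESN N d) (A : SeqSpace q →L[ℝ] SeqSpace q)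
    (C : Vec d →L[ℝ] SeqSpace q) (lam : ℝ) :
    Continuous (transferVec E A C lam : SeqSpace p → Vec N) :=
  (LinearMap.continuous_of_finiteDimensional _).comp
    ((PiLp.continuous_toLp 2 _).comp (continuous_pi fun _ => continuous_seqDot_left _))

theorem measurable_psi (E : ESN N d) (A : SeqSpace q →L[ℝ] SeqSpace q) (B : SeqSpace q)
    (C : Vec d →L[ℝ] SeqSpace q) (lam : ℝ) :
    Measurable (psi E A B C lam : ParamSpace p d → FinParamSpace N d) := by
  have hv : Measurable fun θ : ParamSpace p d => transferVec E A C lam θ.2.1 :=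
    (continuous_transferVec (p := p) E A C lam).measurable.comp (by fun_prop)
  have hB : Measurable fun θ : ParamSpace p d => seqDot θ.2.1 (∑' k : ℕ, (A ^ k) B) :=
    (continuous_seqDot_left (p := p) _).measurable.comp (by fun_prop)
  exact measurable_fst.prodMk (hv.prodMk (Measurable.prodMk (by fun_prop)
    (((hv.inner_const (c := _)).neg.add hB).add (by fun_prop))))

theorem inner_transferVec_response {E : ESN N d} (hK : IsUnit E.K)
    (A : SeqSpace q →L[ℝ] SeqSpace q) (C : Vec d →L[ℝ] SeqSpace q) {lam : ℝ} (hlam : lam ≠ 0)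
    (a : SeqSpace p) (ζ : Fin N → ℝ) :
    inner ℝ (transferVec E A C lam a) (response E.clmA E.clmC ζ) = seqDot a (response A C ζ) := by
  rw [transferVec, E.inner_KinvTΛ_response hK, response, ← seqPairing_apply, map_sum]
  refine Finset.sum_congr rfl fun i _ => ?_
  rw [Lbar, ← seqPairing_apply, smul_pow, smul_apply, map_smul, map_smul, smul_eq_mul, smul_eq_mul,
    ← mul_assoc, ← mul_pow, mul_inv_cancel₀ hlam, one_pow, one_mul, mul_comm]

theorem norm_transferVec_le (E : ESN N d) (A : SeqSpace q →L[ℝ] SeqSpace q)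
    (C : Vec d →L[ℝ] SeqSpace q) (lam : ℝ) (a : SeqSpace p) {T : ℕ} (hT : N ≤ d * T) :
    ‖transferVec E A C lam a‖
      ≤ ‖E.KinvTΛ lam‖ * (‖a‖ * ‖C‖ * √(∑ k ∈ Finset.range T, (‖lam⁻¹ • A‖ ^ k) ^ 2)) := by
  refine (norm_toEuclideanLin_apply_le _ _).trans ?_
  gcongr
  rw [EuclideanSpace.norm_eq]
  simp only [Real.norm_eq_abs, sq_abs, Lbar, ← seqPairing_apply]
  refine (Real.sqrt_le_sqrt (sum_sq_apply_pow_apply_le hT (seqPairing a) (lam⁻¹ • A) C)).trans ?_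
  rw [Real.sqrt_mul (by positivity), Real.sqrt_sq (by positivity)]
  gcongr
  exact norm_seqPairing_apply_le a

theorem networkArg_psi_sub_targetArg {E : ESN N d} (hK : IsUnit E.K)
    (A : SeqSpace q →L[ℝ] SeqSpace q) (B : SeqSpace q) (C : Vec d →L[ℝ] SeqSpace q) {lam : ℝ}
    (hlam : lam ≠ 0) (x : SeqSpace q) (y : Vec N) (z₀ : Vec d) (ζ : Fin N → ℝ)
    (θ : ParamSpace p d) :
    networkArg y z₀ (psi E A B C lam θ) - targetArg x z₀ θ
      = inner ℝ (transferVec E A C lam θ.2.1)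
          (y - (∑ k ∈ Finset.range (horizon N d), (E.clmA ^ k) E.B + response E.clmA E.clmC ζ))
        - seqDot θ.2.1 (x - ∑' k : ℕ, (A ^ k) B - response A C ζ) := by
  have hpsi : networkArg y z₀ (psi E A B C lam θ)
      = inner ℝ (transferVec E A C lam θ.2.1) y + inner ℝ θ.2.2.1 z₀
        + (-inner ℝ (transferVec E A C lam θ.2.1)
            (∑ k ∈ Finset.range (horizon N d), (E.clmA ^ k) E.B)
          + seqDot θ.2.1 (∑' k : ℕ, (A ^ k) B) + θ.2.2.2) := by
    simp only [ESN.clmA_pow_apply]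
    rfl
  rw [hpsi, targetArg, inner_sub_right, inner_add_right, inner_transferVec_response hK A C hlam]
  simp only [← seqPairing_apply, map_sub]
  ring

theorem abs_networkArg_psi_sub_targetArg_le [NeZero N] {E : ESN N d} (hE : ‖E.A‖ < 1)
    (hK : IsUnit E.K) {A : SeqSpace q →L[ℝ] SeqSpace q} (hA : ‖A‖ < 1) {B : SeqSpace q}
    {C : Vec d →L[ℝ] SeqSpace q} {lam : ℝ} (hlam : lam ≠ 0) {z : InputSeq d} {M : ℝ}
    (hz : ∀ n, ‖z n‖ ≤ M) {x : ℕ → SeqSpace q}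
    (hx : IsBoundedState A (fun n => C (z n) + B) x) {y : ℕ → Vec N}
    (hy : IsBoundedState E.clmA (fun n => E.clmC (z n) + E.B) y) (θ : ParamSpace p d) :
    |networkArg (y 1) (z 0) (psi E A B C lam θ) - targetArg (x 1) (z 0) θ|
      ≤ ‖transferVec E A C lam θ.2.1‖
          * (‖E.A‖ ^ (horizon N d - 1) * ((‖E.C‖ * M + ‖E.B‖) / (1 - ‖E.A‖)))
        + ‖θ.2.1‖ * (‖A‖ ^ (horizon N d - 1) * (‖C‖ * M / (1 - ‖A‖))) := by
  have hy_err := hy.norm_sub_response_le (N := N) (E.norm_clmA.trans_lt hE) hz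
  have hx_sub : IsBoundedState A (fun n => C (z n) + 0) (fun n => x n - ∑' k : ℕ, (A ^ k) B) := by
    simpa only [add_zero] using hx.sub_fixedPoint (tsum_pow_apply_eq_apply_add hA B)
  have hx_err := hx_sub.norm_sub_response_le (N := N) hA hz
  simp only [map_zero, Finset.sum_const_zero, zero_add, norm_zero, add_zero] at hx_err
  simp only [E.norm_clmA, E.norm_clmC] at hy_err
  rw [networkArg_psi_sub_targetArg hK A B C hlam (x 1) (y 1) (z 0) (pastInputs N z) θ]
  refine (abs_sub _ _).trans (add_le_add ((abs_real_inner_le_norm _ _).trans ?_)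
    ((abs_seqDot_le _ _).trans ?_))
  · gcongr
  · gcongr

end Transfer

section ImportanceSampling

theorem sq_integral_le_integral_sq {X : Type*} [MeasurableSpace X] {μ : Measure X}
    [IsProbabilityMeasure μ] {h : X → ℝ} (hh : MemLp h 2 μ) :
    (∫ x, h x ∂μ) ^ 2 ≤ ∫ x, h x ^ 2 ∂μ := by
  have hvar := variance_eq_sub hh
  simp only [Pi.pow_apply] at hvar
  linarith [variance_nonneg h μ]

theorem integral_sq_const_sub {Ω : Type*} [MeasurableSpace Ω] {P : Measure Ω}
    [IsProbabilityMeasure P] {Z : Ω → ℝ} (hZ : MemLp Z 2 P) (c : ℝ) :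
    ∫ ω, (c - Z ω) ^ 2 ∂P = (c - ∫ ω, Z ω ∂P) ^ 2 + Var[Z; P] := by
  have hvar : Var[fun ω => c - Z ω; P] = ∫ ω, (c - Z ω) ^ 2 ∂P - (∫ ω, (c - Z ω) ∂P) ^ 2 :=
    variance_eq_sub ((memLp_const c).sub hZ)
  have hmean : ∫ ω, (c - Z ω) ∂P = c - ∫ ω, Z ω ∂P := by
    simp [integral_sub (integrable_const c) (hZ.integrable one_le_two)]
  rw [variance_const_sub hZ.1, hmean] at hvar
  linarith

theorem variance_sampleMean_le {Ω : Type*} [MeasurableSpace Ω] {P : Measure Ω}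
    [IsProbabilityMeasure P] {N : ℕ} {Y : Fin N → Ω → ℝ} (hY : ∀ i, MemLp (Y i) 2 P)
    (hindep : Pairwise fun i j => IndepFun (Y i) (Y j) P) {v : ℝ}
    (hv : ∀ i, ∫ ω, Y i ω ^ 2 ∂P ≤ v) :
    Var[fun ω => (N : ℝ)⁻¹ * ∑ i, Y i ω; P] ≤ v / N := by
  have hsum : (fun ω => ∑ i, Y i ω) = ∑ i, Y i := by
    ext ω
    simp
  rw [variance_const_mul, hsum,
    IndepFun.variance_sum (fun i _ => hY i) fun i _ j _ hij => hindep hij]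
  calc ((N : ℝ)⁻¹) ^ 2 * ∑ i, Var[Y i; P] ≤ ((N : ℝ)⁻¹) ^ 2 * ∑ _i : Fin N, v := by
        gcongr with i
        exact (variance_le_expectation_sq (hY i).1).trans (hv i)
    _ = v / N := by
        rw [Finset.sum_const, Finset.card_univ, Fintype.card_fin, nsmul_eq_mul]
        field_simp

variable {X Ω : Type*} [MeasurableSpace X] [MeasurableSpace Ω] {κ ν : Measure X}

theorem one_le_essSup_rnDeriv [IsProbabilityMeasure κ] [IsProbabilityMeasure ν] (hac : κ ≪ ν) :
    1 ≤ essSup (κ.rnDeriv ν) ν := by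
  calc (1 : ℝ≥0∞) = ∫⁻ x, κ.rnDeriv ν x ∂ν := by
        rw [Measure.lintegral_rnDeriv hac, measure_univ]
    _ ≤ ∫⁻ _, essSup (κ.rnDeriv ν) ν ∂ν := lintegral_mono_ae (ENNReal.ae_le_essSup _)
    _ = essSup (κ.rnDeriv ν) ν := by simp

theorem sq_rnDeriv_mul_le (hb : essSup (κ.rnDeriv ν) ν < ∞) (h : X → ℝ) :
    ∀ᵐ x ∂ν, ((κ.rnDeriv ν x).toReal * h x) ^ 2
      ≤ (essSup (κ.rnDeriv ν) ν).toReal * ((κ.rnDeriv ν x).toReal • h x ^ 2) := by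
  filter_upwards [ENNReal.ae_le_essSup (μ := ν) (κ.rnDeriv ν)] with x hx
  have hle : (κ.rnDeriv ν x).toReal ≤ (essSup (κ.rnDeriv ν) ν).toReal :=
    ENNReal.toReal_mono hb.ne hx
  calc ((κ.rnDeriv ν x).toReal * h x) ^ 2
      = (κ.rnDeriv ν x).toReal * ((κ.rnDeriv ν x).toReal • h x ^ 2) := by
        rw [smul_eq_mul]
        ring
    _ ≤ (essSup (κ.rnDeriv ν) ν).toReal * ((κ.rnDeriv ν x).toReal • h x ^ 2) := by
        gcongr

variable [IsFiniteMeasure κ] [IsFiniteMeasure ν]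

theorem memLp_rnDeriv_mul (hac : κ ≪ ν) (hb : essSup (κ.rnDeriv ν) ν < ∞) {h : X → ℝ}
    (hm : Measurable h) (hh : MemLp h 2 κ) :
    MemLp (fun x => (κ.rnDeriv ν x).toReal * h x) 2 ν := by
  have hmeas : Measurable fun x => (κ.rnDeriv ν x).toReal * h x :=
    (Measure.measurable_rnDeriv κ ν).ennreal_toReal.mul hm
  refine (memLp_two_iff_integrable_sq hmeas.aestronglyMeasurable).2 ?_
  refine Integrable.mono' (((integrable_rnDeriv_smul_iff hac).2 hh.integrable_sq).const_mul
    (essSup (κ.rnDeriv ν) ν).toReal) (hmeas.pow_const 2).aestronglyMeasurable ?_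
  filter_upwards [sq_rnDeriv_mul_le hb h] with x hx
  rwa [Real.norm_of_nonneg (sq_nonneg _)]

theorem integral_sq_rnDeriv_mul_le (hac : κ ≪ ν) (hb : essSup (κ.rnDeriv ν) ν < ∞) {h : X → ℝ}
    (hm : Measurable h) (hh : MemLp h 2 κ) :
    ∫ x, ((κ.rnDeriv ν x).toReal * h x) ^ 2 ∂ν
      ≤ (essSup (κ.rnDeriv ν) ν).toReal * ∫ x, h x ^ 2 ∂κ := by
  refine (integral_mono_ae (memLp_rnDeriv_mul hac hb hm hh).integrable_sq
    (((integrable_rnDeriv_smul_iff hac).2 hh.integrable_sq).const_mul _)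
    (sq_rnDeriv_mul_le hb h)).trans_eq ?_
  rw [integral_const_mul, integral_rnDeriv_smul hac]

/-- The importance sampling estimator of `∫ h dκ`, from points `x` sampled from `ν`. -/
noncomputable def importanceMean {N : ℕ} (κ ν : Measure X) (h : X → ℝ) (x : Fin N → X) : ℝ :=
  (N : ℝ)⁻¹ * ∑ i, (κ.rnDeriv ν (x i)).toReal * h (x i)

variable {P : Measure Ω} {N : ℕ} {θ : Fin N → Ω → X} {h : X → ℝ}

theorem memLp_importanceMean (hac : κ ≪ ν) (hb : essSup (κ.rnDeriv ν) ν < ∞)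
    (hm : Measurable h) (hh : MemLp h 2 κ) (hlaw : ∀ i, MeasurePreserving (θ i) P ν) :
    MemLp (fun ω => importanceMean κ ν h fun i => θ i ω) 2 P :=
  (memLp_finsetSum _ fun i _ =>
    (memLp_rnDeriv_mul hac hb hm hh).comp_measurePreserving (hlaw i)).const_mul _

theorem integral_sq_sub_importanceMean_le [IsProbabilityMeasure P] [NeZero N] (hac : κ ≪ ν)
    (hb : essSup (κ.rnDeriv ν) ν < ∞) (hm : Measurable h) (hh : MemLp h 2 κ)
    (hlaw : ∀ i, MeasurePreserving (θ i) P ν)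
    (hindep : Pairwise fun i j => IndepFun (θ i) (θ j) P) (c : ℝ) :
    ∫ ω, (c - importanceMean κ ν h fun i => θ i ω) ^ 2 ∂P
      ≤ (c - ∫ x, h x ∂κ) ^ 2 + (essSup (κ.rnDeriv ν) ν).toReal / N * ∫ x, h x ^ 2 ∂κ := by
  set F : X → ℝ := fun x => (κ.rnDeriv ν x).toReal * h x
  have hFm : Measurable F := (Measure.measurable_rnDeriv κ ν).ennreal_toReal.mul hm
  have hF : MemLp F 2 ν := memLp_rnDeriv_mul hac hb hm hh
  have hY : ∀ i, MemLp (fun ω => F (θ i ω)) 2 P := fun i => hF.comp_measurePreserving (hlaw i)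
  have hmap : ∀ i {g : X → ℝ}, Measurable g → ∫ ω, g (θ i ω) ∂P = ∫ x, g x ∂ν := fun i g hg => by
    rw [← (hlaw i).map_eq, integral_map (hlaw i).aemeasurable hg.aestronglyMeasurable]
  have hmean : ∫ ω, (importanceMean κ ν h fun i => θ i ω) ∂P = ∫ x, h x ∂κ := by
    have hF_mean : ∫ x, F x ∂ν = ∫ x, h x ∂κ := integral_rnDeriv_smul hac
    have hN : (N : ℝ) ≠ 0 := mod_cast NeZero.ne N
    simp only [importanceMean]
    rw [integral_const_mul, integral_finsetSum _ fun i _ => (hY i).integrable one_le_two]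
    simp [hmap _ hFm, hF_mean, hN]
  rw [integral_sq_const_sub (memLp_importanceMean hac hb hm hh hlaw), hmean]
  gcongr
  rw [div_mul_eq_mul_div]
  exact variance_sampleMean_le hY (fun i j hij => (hindep hij).comp hFm hFm) fun i =>
    (hmap i (hFm.pow_const 2)).trans_le (integral_sq_rnDeriv_mul_le hac hb hm hh)

end ImportanceSampling

section Moment

variable {p : ℝ≥0∞} {d : ℕ}

/-- The size `|w| (‖a‖² + ‖c‖² + |b|² + 1)^{1/2}` of a parameter, the integrand behind
`I_{μ,p}^{(2)}`. -/
noncomputable def paramSize (θ : ParamSpace p d) : ℝ :=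
  |θ.1| * √(‖θ.2.1‖ ^ 2 + ‖θ.2.2.1‖ ^ 2 + ‖θ.2.2.2‖ ^ 2 + 1)

variable [Fact (1 ≤ p)] {μ : Measure (ParamSpace p d)}

theorem enorm_paramSize_sq (θ : ParamSpace p d) :
    ‖paramSize θ‖ₑ ^ 2
      = ‖θ.1‖ₑ ^ 2 * (‖θ.2.1‖ₑ ^ 2 + ‖θ.2.2.1‖ₑ ^ 2 + ‖θ.2.2.2‖ₑ ^ 2 + 1) := by
  have hsum : ‖‖θ.2.1‖ ^ 2 + ‖θ.2.2.1‖ ^ 2 + ‖θ.2.2.2‖ ^ 2 + 1‖ₑ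
      = ‖θ.2.1‖ₑ ^ 2 + ‖θ.2.2.1‖ₑ ^ 2 + ‖θ.2.2.2‖ₑ ^ 2 + 1 := by
    rw [Real.enorm_of_nonneg (by positivity), ENNReal.ofReal_add (by positivity) zero_le_one,
      ENNReal.ofReal_add (by positivity) (by positivity),
      ENNReal.ofReal_add (by positivity) (by positivity)]
    simp only [ENNReal.ofReal_pow (norm_nonneg _), ofReal_norm, ENNReal.ofReal_one]
  rw [← enorm_pow, paramSize, mul_pow, Real.sq_sqrt (by positivity), sq_abs, enorm_mul, enorm_pow,
    hsum]

theorem measurable_paramSize : Measurable (paramSize : ParamSpace p d → ℝ) := by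
  unfold paramSize
  fun_prop

theorem eLpNorm_paramSize : eLpNorm paramSize 2 μ = barronMoment₂ μ := by
  rw [eLpNorm_eq_lintegral_rpow_enorm_toReal two_ne_zero ENNReal.ofNat_ne_top, barronMoment₂]
  simp only [ENNReal.toReal_ofNat, ENNReal.rpow_ofNat, enorm_paramSize_sq]

theorem memLp_paramSize (hμ : barronMoment₂ μ < ∞) : MemLp paramSize 2 μ :=
  ⟨measurable_paramSize.aestronglyMeasurable, eLpNorm_paramSize.trans_lt hμ⟩

theorem integral_sq_paramSize (hμ : barronMoment₂ μ < ∞) :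
    ∫ θ, paramSize θ ^ 2 ∂μ = (barronMoment₂ μ).toReal ^ 2 := by
  rw [← eLpNorm_paramSize,
    (memLp_paramSize hμ).eLpNorm_eq_integral_rpow_norm two_ne_zero ENNReal.ofNat_ne_top,
    ENNReal.toReal_ofReal (by positivity)]
  simp only [ENNReal.toReal_ofNat, Real.rpow_ofNat, Real.norm_eq_abs, sq_abs]
  exact (Real.rpow_inv_natCast_pow (integral_nonneg fun _ => sq_nonneg _) two_ne_zero).symm

theorem memLp_of_abs_le_paramSize (hμ : barronMoment₂ μ < ∞) {h : ParamSpace p d → ℝ}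
    (hm : Measurable h) {c : ℝ} (hle : ∀ θ, |h θ| ≤ c * paramSize θ) : MemLp h 2 μ :=
  ((memLp_paramSize hμ).const_mul c).mono' hm.aestronglyMeasurable (ae_of_all _ hle)

theorem integral_sq_le_of_abs_le_paramSize (hμ : barronMoment₂ μ < ∞) {h : ParamSpace p d → ℝ}
    (hm : Measurable h) {c : ℝ} (hle : ∀ θ, |h θ| ≤ c * paramSize θ) :
    ∫ θ, h θ ^ 2 ∂μ ≤ (c * (barronMoment₂ μ).toReal) ^ 2 := by
  have hsize := memLp_paramSize hμ
  calc ∫ θ, h θ ^ 2 ∂μ ≤ ∫ θ, c ^ 2 * paramSize θ ^ 2 ∂μ := by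
        refine integral_mono (memLp_of_abs_le_paramSize hμ hm hle).integrable_sq
          (hsize.integrable_sq.const_mul _) fun θ => ?_
        dsimp only
        rw [← mul_pow, ← sq_abs]
        gcongr
        exact hle θ
    _ = (c * (barronMoment₂ μ).toReal) ^ 2 := by
        rw [integral_const_mul, mul_pow, integral_sq_paramSize hμ]

theorem abs_integral_le_of_abs_le_paramSize [IsProbabilityMeasure μ] (hμ : barronMoment₂ μ < ∞)
    {h : ParamSpace p d → ℝ} (hm : Measurable h) {c : ℝ} (hc : 0 ≤ c)
    (hle : ∀ θ, |h θ| ≤ c * paramSize θ) : |∫ θ, h θ ∂μ| ≤ c * (barronMoment₂ μ).toReal :=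
  abs_le_of_sq_le_sq ((sq_integral_le_integral_sq (memLp_of_abs_le_paramSize hμ hm hle)).trans
    (integral_sq_le_of_abs_le_paramSize hμ hm hle)) (mul_nonneg hc ENNReal.toReal_nonneg)

end Moment

section Rates

theorem choose_mul_pow_le {r : ℝ} (h0 : 0 ≤ r) (h1 : r < 1) (k n : ℕ) :
    ((n + k + 1).choose (k + 1) : ℝ) * r ^ n ≤ 1 / (1 - r) ^ (k + 1) := by
  have hsum := hasSum_choose_mul_geometric_of_norm_lt_one k (by rwa [Real.norm_of_nonneg h0])
  rw [← Nat.sum_range_add_choose, Nat.cast_sum, Finset.sum_mul]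
  calc ∑ i ∈ Finset.range (n + 1), ((i + k).choose k : ℝ) * r ^ n
      ≤ ∑ i ∈ Finset.range (n + 1), ((i + k).choose k : ℝ) * r ^ i := by
        refine Finset.sum_le_sum fun i hi => ?_
        exact mul_le_mul_of_nonneg_left (pow_le_pow_of_le_one h0 h1.le
          (Finset.mem_range_succ_iff.1 hi)) (Nat.cast_nonneg _)
    _ ≤ 1 / (1 - r) ^ (k + 1) := sum_le_hasSum _ (fun _ _ => by positivity) hsum

theorem sq_mul_pow_pred_le {r : ℝ} (h0 : 0 ≤ r) (h1 : r < 1) (T : ℕ) :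
    (T : ℝ) ^ 2 * r ^ (T - 1) ≤ 2 * (1 / (1 - r)) ^ 2 := by
  rcases T with _ | n
  · simp only [Nat.cast_zero, ne_eq, OfNat.ofNat_ne_zero, not_false_eq_true, zero_pow, zero_mul]
    positivity
  · have h := choose_mul_pow_le h0 h1 1 n
    rw [Nat.cast_choose_two] at h
    have hn : 0 ≤ ((n : ℝ) + 1) * r ^ n := by positivity
    rw [div_pow, one_pow]
    push_cast at h ⊢
    nlinarith

theorem sum_pow_rpow_le {r s : ℝ} (h0 : 0 ≤ r) (h1 : r < 1) (hs : 0 < s) (T : ℕ) :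
    ∑ k ∈ Finset.range T, (r ^ k) ^ s ≤ (1 - r ^ s)⁻¹ := by
  simp only [← Real.rpow_pow_comm h0]
  have hr : 0 ≤ r ^ s := Real.rpow_nonneg h0 s
  exact sum_le_hasSum _ (fun _ _ => by positivity)
    (hasSum_geometric_of_lt_one hr (Real.rpow_lt_one h0 h1 hs))

theorem sum_rpow_le_rpow_sum {ι : Type*} (s : Finset ι) {f : ι → ℝ} (hf : ∀ i, 0 ≤ f i) {r : ℝ}
    (hr : 1 ≤ r) : ∑ i ∈ s, f i ^ r ≤ (∑ i ∈ s, f i) ^ r := by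
  classical
  induction s using Finset.induction_on with
  | empty => simp [Real.zero_rpow (zero_lt_one.trans_le hr).ne']
  | insert i s hi ih =>
    rw [Finset.sum_insert hi, Finset.sum_insert hi]
    exact (add_le_add_right ih _).trans
      (Real.add_rpow_le_rpow_add (hf i) (Finset.sum_nonneg fun j _ => hf j) hr)

/-- The exponent of `T` in the norm `T^γ` of the inclusion of `ℓ^p` into `ℓ^2` in dimension `T`. -/
noncomputable def inclusionExponent (p : ℝ) : ℝ := max 0 (1 / 2 - 1 / p)

theorem inclusionExponent_of_le_two {p : ℝ} (h0 : 0 < p) (hp : p ≤ 2) :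
    inclusionExponent p = 0 :=
  max_eq_left (sub_nonpos.2 (one_div_le_one_div_of_le h0 hp))

theorem inclusionExponent_of_two_le {p : ℝ} (hp : 2 ≤ p) :
    inclusionExponent p = 1 / 2 - 1 / p :=
  max_eq_right (sub_nonneg.2 (one_div_le_one_div_of_le two_pos hp))

theorem sqrt_sum_sq_le {ι : Type*} (s : Finset ι) {f : ι → ℝ} (hf : ∀ i, 0 ≤ f i) {p : ℝ}
    (hp : 0 < p) :
    √(∑ i ∈ s, f i ^ 2)
      ≤ (s.card : ℝ) ^ inclusionExponent p * (∑ i ∈ s, f i ^ p) ^ (1 / p) := by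
  have hsum : 0 ≤ ∑ i ∈ s, f i ^ p := Finset.sum_nonneg fun i _ => Real.rpow_nonneg (hf i) p
  have hsum_sq : 0 ≤ ∑ i ∈ s, f i ^ 2 := Finset.sum_nonneg fun i _ => sq_nonneg (f i)
  rw [Real.sqrt_eq_rpow]
  rcases le_total p 2 with hp2 | hp2
  · rw [inclusionExponent_of_le_two hp hp2, Real.rpow_zero, one_mul]
    have hsq : ∀ i, f i ^ 2 = (f i ^ p) ^ (2 / p) := fun i => by
      rw [← Real.rpow_mul (hf i), mul_div_cancel₀ _ hp.ne', Real.rpow_two]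
    calc (∑ i ∈ s, f i ^ 2) ^ (1 / 2 : ℝ)
        ≤ ((∑ i ∈ s, f i ^ p) ^ (2 / p)) ^ (1 / 2 : ℝ) := by
          simp only [hsq] at hsum_sq ⊢
          gcongr
          exact sum_rpow_le_rpow_sum s (fun i => Real.rpow_nonneg (hf i) p)
            ((one_le_div hp).2 hp2)
      _ = (∑ i ∈ s, f i ^ p) ^ (1 / p) := by
          rw [← Real.rpow_mul hsum]
          ring_nf
  · rw [inclusionExponent_of_two_le hp2]
    have hpow : ∀ i, (f i ^ 2) ^ (p / 2) = f i ^ p := fun i => by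
      rw [← Real.rpow_two, ← Real.rpow_mul (hf i), mul_div_cancel₀ _ two_ne_zero]
    have hmean : (∑ i ∈ s, f i ^ 2) ^ (p / 2) ≤ (s.card : ℝ) ^ (p / 2 - 1) * ∑ i ∈ s, f i ^ p := by
      simpa only [hpow] using Real.rpow_sum_le_const_mul_sum_rpow_of_nonneg s
        ((one_le_div two_pos).2 hp2) fun i _ => sq_nonneg (f i)
    calc (∑ i ∈ s, f i ^ 2) ^ (1 / 2 : ℝ)
        = ((∑ i ∈ s, f i ^ 2) ^ (p / 2)) ^ (1 / p) := by
          rw [← Real.rpow_mul hsum_sq]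
          field_simp
      _ ≤ ((s.card : ℝ) ^ (p / 2 - 1) * ∑ i ∈ s, f i ^ p) ^ (1 / p) := by gcongr
      _ = (s.card : ℝ) ^ (1 / 2 - 1 / p) * (∑ i ∈ s, f i ^ p) ^ (1 / p) := by
          rw [Real.mul_rpow (by positivity) hsum, ← Real.rpow_mul (by positivity)]
          field_simp

theorem sqrt_sum_pow_sq_le {r p : ℝ} (hp : 0 < p) (h0 : 0 ≤ r) (h1 : r < 1) (T : ℕ) :
    √(∑ k ∈ Finset.range T, (r ^ k) ^ 2)
      ≤ (T : ℝ) ^ inclusionExponent p / (1 - r ^ p) ^ (1 / p) := by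
  have hr : 0 ≤ 1 - r ^ p := sub_nonneg.2 (Real.rpow_le_one h0 h1.le hp.le)
  refine (sqrt_sum_sq_le _ (fun k => pow_nonneg h0 k) hp).trans ?_
  rw [Finset.card_range, div_eq_mul_inv _ ((1 - r ^ p) ^ _), ← Real.inv_rpow hr]
  gcongr
  exact sum_pow_rpow_le h0 h1 hp T

theorem inclusionExponent_nonneg (p : ℝ) : 0 ≤ inclusionExponent p := le_max_left _ _

theorem inclusionExponent_le_half {p : ℝ} (hp : 0 < p) : inclusionExponent p ≤ 1 / 2 :=
  max_le (by norm_num) (sub_le_self _ (by positivity))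

/-- The power of `d` that enters `cTilde`. -/
noncomputable def dimFactor (d : ℕ) (p : ℝ) : ℝ :=
  (d : ℝ) ^ (1 / (2 * p) + 2 * inclusionExponent p)

theorem dimFactor_eq (d : ℕ) [NeZero d] {p q : ℝ} (hpq : p.HolderConjugate q) :
    max 1 ((d : ℝ) ^ (1 / 2 - 1 / p)) * (d : ℝ) ^ (1 / (2 * p))
      * max 1 ((d : ℝ) ^ (1 / q - 1 / 2)) = dimFactor d p := by
  have hd : (1 : ℝ) ≤ d := Nat.one_le_cast.2 NeZero.one_le
  have hmax : ∀ x : ℝ, max 1 ((d : ℝ) ^ x) = (d : ℝ) ^ max 0 x := fun x => by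
    rw [(Real.monotone_rpow_of_base_ge_one hd).map_max, Real.rpow_zero]
  have hq : 1 / q - 1 / 2 = 1 / 2 - 1 / p := by
    linarith [hpq.inv_add_inv_eq_one, one_div p, one_div q]
  rw [hq, hmax, dimFactor, inclusionExponent, ← Real.rpow_add (by positivity),
    ← Real.rpow_add (by positivity)]
  ring_nf

theorem rpow_le_dimFactor {d : ℕ} [NeZero d] {p s : ℝ}
    (hs : s ≤ 1 / (2 * p) + 2 * inclusionExponent p) : (d : ℝ) ^ s ≤ dimFactor d p :=
  Real.rpow_le_rpow_of_exponent_le (Nat.one_le_cast.2 NeZero.one_le) hs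

theorem one_le_dimFactor {d : ℕ} [NeZero d] {p : ℝ} (hp : 0 < p) : 1 ≤ dimFactor d p := by
  rw [← Real.rpow_zero (d : ℝ)]
  exact rpow_le_dimFactor (add_nonneg (by positivity)
    (mul_nonneg two_pos.le (inclusionExponent_nonneg p)))

theorem sqrt_le_dimFactor_sq (d : ℕ) [NeZero d] (p : ℝ) : √(d : ℝ) ≤ dimFactor d p ^ 2 := by
  have hexp : 1 / 4 ≤ 1 / (2 * p) + 2 * inclusionExponent p := by
    have h0 := inclusionExponent_nonneg p
    have h1 : 1 / 2 - 1 / p ≤ inclusionExponent p := le_max_right _ _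
    ring_nf at h1 ⊢
    linarith
  calc √(d : ℝ) = ((d : ℝ) ^ (1 / 4 : ℝ)) ^ 2 := by
        rw [← Real.rpow_mul_natCast (by positivity), Real.sqrt_eq_rpow]
        norm_num
    _ ≤ dimFactor d p ^ 2 := by
        gcongr
        exact rpow_le_dimFactor hexp

theorem rpow_mul_le_rpow_mul_add {γ t x y K : ℝ} (hγ0 : 0 ≤ γ) (hγ : γ ≤ 1 / 2) (ht : 0 ≤ t)
    (hx : 0 ≤ x) (hy : 0 ≤ y) (hK : 0 ≤ K) (h : √t * y ≤ K * x) :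
    t ^ γ * y ≤ K ^ (2 * γ) * (y + x) := by
  rcases hy.eq_or_lt with rfl | hy
  · rw [mul_zero]
    positivity
  have hmean : x ^ (2 * γ) * y ^ (1 - 2 * γ) ≤ y + x := by
    refine (Real.geom_mean_le_arith_mean2_weighted (by linarith) (by linarith) hx hy.le
      (by ring)).trans ?_
    nlinarith
  calc t ^ γ * y = (√t * y) ^ (2 * γ) * y ^ (1 - 2 * γ) := by
        rw [Real.mul_rpow (Real.sqrt_nonneg t) hy.le, mul_assoc, ← Real.rpow_add hy,
          Real.sqrt_eq_rpow, ← Real.rpow_mul ht]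
        ring_nf
        rw [Real.rpow_one]
    _ ≤ (K * x) ^ (2 * γ) * y ^ (1 - 2 * γ) := by gcongr
    _ = K ^ (2 * γ) * (x ^ (2 * γ) * y ^ (1 - 2 * γ)) := by
        rw [Real.mul_rpow hK hx, mul_assoc]
    _ ≤ K ^ (2 * γ) * (y + x) := by gcongr

theorem mul_pow_pred_le {ε Γ D : ℝ} {T N d : ℕ} (hε0 : 0 ≤ ε) (hε1 : ε < 1) (hd : 0 < d)
    (hD : 0 ≤ D) (hDd : √(d : ℝ) ≤ D ^ 2) (hNT : N ≤ d * T) (hΓ : 1 / (1 - ε) ≤ Γ)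
    (hΓD : Γ * D ≤ √N) : T * ε ^ (T - 1) ≤ 2 * √d := by
  rcases T.eq_zero_or_pos with rfl | hT
  · simp
  have hd' : (0 : ℝ) < d := Nat.cast_pos.2 hd
  have hΓ0 : 0 ≤ Γ := le_trans (by positivity) hΓ
  have hNT' : (N : ℝ) ≤ d * T := by exact_mod_cast hNT
  have hchain : T * √d * (T * ε ^ (T - 1)) ≤ T * √d * (2 * √d) := by
    calc T * √d * (T * ε ^ (T - 1)) = √d * (T ^ 2 * ε ^ (T - 1)) := by ring
      _ ≤ D ^ 2 * (2 * Γ ^ 2) := by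
          have hgeom : (T : ℝ) ^ 2 * ε ^ (T - 1) ≤ 2 * Γ ^ 2 :=
            (sq_mul_pow_pred_le hε0 hε1 T).trans (by gcongr)
          exact mul_le_mul hDd hgeom (by positivity) (by positivity)
      _ = 2 * (Γ * D) ^ 2 := by ring
      _ ≤ 2 * √N ^ 2 := by gcongr
      _ ≤ 2 * (d * T) := by rw [Real.sq_sqrt (Nat.cast_nonneg N)]; gcongr
      _ = T * √d * (2 * √d) := by linear_combination (-2 * T : ℝ) * Real.mul_self_sqrt hd'.le
  exact le_of_mul_le_mul_left hchain (by positivity)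

theorem rpow_mul_pow_pred_le {γ ε Γ D : ℝ} {T N d : ℕ} (hγ0 : 0 ≤ γ) (hγ : γ ≤ 1 / 2)
    (hε0 : 0 ≤ ε) (hε1 : ε < 1) (hd : 0 < d) (hN : 0 < N) (hDd : √(d : ℝ) ≤ D ^ 2)
    (hdD : (d : ℝ) ^ (2 * γ) ≤ D) (hNT : N ≤ d * T) (hΓ : 1 / (1 - ε) ≤ Γ) (hΓD : Γ * D ≤ √N) :
    (T : ℝ) ^ γ * ε ^ (T - 1) ≤ 2 * D * (ε ^ (T - 1) + 1 / √N) := by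
  have hD : 0 ≤ D := le_trans (by positivity) hdD
  have hNT' : √(N : ℝ) ≤ √d * √T := by
    rw [← Real.sqrt_mul (Nat.cast_nonneg d)]
    exact Real.sqrt_le_sqrt (by exact_mod_cast hNT)
  have hsqrt : √(T : ℝ) * ε ^ (T - 1) ≤ 2 * d * (1 / √N) := by
    rw [mul_one_div, le_div_iff₀ (by positivity)]
    calc √(T : ℝ) * ε ^ (T - 1) * √N ≤ √(T : ℝ) * ε ^ (T - 1) * (√d * √T) := by gcongr
      _ = √d * (T * ε ^ (T - 1)) := by
          linear_combination √d * ε ^ (T - 1) * Real.mul_self_sqrt (Nat.cast_nonneg T)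
      _ ≤ √d * (2 * √d) := by
          exact mul_le_mul_of_nonneg_left
            (mul_pow_pred_le hε0 hε1 hd hD hDd hNT hΓ hΓD) (Real.sqrt_nonneg _)
      _ = 2 * d := by linear_combination 2 * Real.mul_self_sqrt (Nat.cast_nonneg d)
  refine (rpow_mul_le_rpow_mul_add hγ0 hγ (Nat.cast_nonneg T) (by positivity) (by positivity)
    (by positivity) hsqrt).trans ?_
  gcongr
  rw [Real.mul_rpow two_pos.le (Nat.cast_nonneg d)]
  gcongr
  exact Real.rpow_le_self_of_one_le one_le_two (by linarith)

theorem pow_pred_le_inv_mul_add {ε l : ℝ} (hε : 0 ≤ ε) (hl : 0 < l) {T : ℕ} (hT : 0 < T) :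
    ε ^ (T - 1) ≤ l⁻¹ * (l ^ T + ε ^ T) := by
  obtain ⟨n, rfl⟩ := Nat.exists_eq_add_one.2 hT
  rw [Nat.add_sub_cancel, ← div_eq_inv_mul, le_div_iff₀ hl, pow_succ, pow_succ]
  rcases le_total ε l with h | h
  · have : ε ^ n * l ≤ l ^ n * l := by gcongr
    linarith [mul_nonneg (pow_nonneg hε n) hε]
  · have : ε ^ n * l ≤ ε ^ n * ε := by gcongr
    linarith [mul_pos (pow_pos hl n) hl]

end Rates

section Neuron

variable {σ : ℝ → ℝ} {L : ℝ≥0} {p : ℝ≥0∞} {d : ℕ} {θ : ParamSpace p d} {G η t t' : ℝ}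

/-- The factor of `cTilde` that depends on the activation function. -/
noncomputable def activationScale (L s₀ : ℝ) : ℝ := max (max L |s₀|) 1

theorem activationScale_pos (L s₀ : ℝ) : 0 < activationScale L s₀ :=
  zero_lt_one.trans_le (le_max_right _ _)

theorem abs_activation_sub_le (hσ : LipschitzWith L σ) (t t' : ℝ) :
    |σ t' - σ t| ≤ activationScale L (σ 0) * |t' - t| := by
  refine (hσ.dist_le_mul t' t).trans (mul_le_mul_of_nonneg_right ?_ dist_nonneg)
  exact (le_max_left _ _).trans (le_max_left _ _)

theorem abs_activation_le (hσ : LipschitzWith L σ) (t : ℝ) :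
    |σ t| ≤ activationScale L (σ 0) * (1 + |t|) := by
  have hsub := abs_activation_sub_le hσ 0 t
  have hzero : |σ 0| ≤ activationScale L (σ 0) := (le_max_right _ _).trans (le_max_left _ _)
  rw [sub_zero] at hsub
  linarith [abs_sub_abs_le_abs_sub (σ t) (σ 0)]

theorem one_add_le_sqrt_seven_mul (a c b : ℝ) :
    1 + (2 * a + c + b) ≤ √7 * √(a ^ 2 + c ^ 2 + b ^ 2 + 1) := by
  rw [← Real.sqrt_mul (by norm_num)]
  refine Real.le_sqrt_of_sq_le ?_
  nlinarith [sq_nonneg (a - 2), sq_nonneg (a - 2 * c), sq_nonneg (a - 2 * b), sq_nonneg (c - b),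
    sq_nonneg (c - 1), sq_nonneg (b - 1)]

theorem abs_mul_norm_le_paramSize (θ : ParamSpace p d) : |θ.1| * ‖θ.2.1‖ ≤ paramSize θ :=
  mul_le_mul_of_nonneg_left (Real.le_sqrt_of_sq_le (by
    linarith [sq_nonneg (‖θ.2.2.1‖), sq_nonneg (‖θ.2.2.2‖)])) (abs_nonneg _)

theorem abs_mul_activation_le (hσ : LipschitzWith L σ) (hG : 1 ≤ G) (hη : 0 ≤ η)
    (ht : |t| ≤ G * ((2 + η) * ‖θ.2.1‖ + ‖θ.2.2.1‖ + ‖θ.2.2.2‖)) :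
    |θ.1 * σ t| ≤ activationScale L (σ 0) * G * (√7 + η) * paramSize θ := by
  have hS := activationScale_pos L (σ 0)
  have hCS : |θ.1| * (1 + (2 * ‖θ.2.1‖ + ‖θ.2.2.1‖ + ‖θ.2.2.2‖)) ≤ √7 * paramSize θ := by
    rw [paramSize, mul_left_comm]
    gcongr
    exact one_add_le_sqrt_seven_mul _ _ _
  calc |θ.1 * σ t| ≤ |θ.1| * (activationScale L (σ 0) * (1 + |t|)) := by
        rw [abs_mul]
        gcongr
        exact abs_activation_le hσ t
    _ ≤ |θ.1| * (activationScale L (σ 0)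
          * (G * (1 + ((2 + η) * ‖θ.2.1‖ + ‖θ.2.2.1‖ + ‖θ.2.2.2‖)))) := by
        gcongr
        linarith
    _ = activationScale L (σ 0) * G * (|θ.1| * (1 + (2 * ‖θ.2.1‖ + ‖θ.2.2.1‖ + ‖θ.2.2.2‖))
          + η * (|θ.1| * ‖θ.2.1‖)) := by ring
    _ ≤ activationScale L (σ 0) * G * (√7 * paramSize θ + η * paramSize θ) := by
        gcongr
        exact abs_mul_norm_le_paramSize θ
    _ = activationScale L (σ 0) * G * (√7 + η) * paramSize θ := by ring

theorem abs_mul_activation_sub_le (hσ : LipschitzWith L σ) (hG : 0 ≤ G) (hη : 0 ≤ η)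
    (ht : |t' - t| ≤ G * η * ‖θ.2.1‖) :
    |θ.1 * σ t' - θ.1 * σ t| ≤ activationScale L (σ 0) * G * η * paramSize θ := by
  have hS := activationScale_pos L (σ 0)
  calc |θ.1 * σ t' - θ.1 * σ t| ≤ |θ.1| * (activationScale L (σ 0) * (G * η * ‖θ.2.1‖)) := by
        rw [← mul_sub, abs_mul]
        gcongr
        exact (abs_activation_sub_le hσ t t').trans (by gcongr)
    _ = activationScale L (σ 0) * G * η * (|θ.1| * ‖θ.2.1‖) := by ring
    _ ≤ activationScale L (σ 0) * G * η * paramSize θ := by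
        gcongr
        exact abs_mul_norm_le_paramSize θ

end Neuron

section Constants

variable {p q : ℝ≥0∞} [Fact (1 ≤ q)] {N d : ℕ}

/-- The factor of `constHESN` that depends on the target system. -/
noncomputable def systemConst (p : ℝ) (A : SeqSpace q →L[ℝ] SeqSpace q) (B : SeqSpace q)
    (C : Vec d →L[ℝ] SeqSpace q) (lam : ℝ) : ℝ :=
  max (max (‖C‖ / (1 - ‖lam⁻¹ • A‖ ^ p) ^ (1 / p)) (‖B‖ / (1 - ‖A‖))) 1

/-- The scale `G` of the arguments of `σ₂`: they are at most `G (2 ‖a‖ + ‖c‖ + |b|)`. -/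
noncomputable def argScale (p : ℝ) (A : SeqSpace q →L[ℝ] SeqSpace q) (B : SeqSpace q)
    (C : Vec d →L[ℝ] SeqSpace q) (M lam : ℝ) : ℝ :=
  max M 1 * (1 - lam)⁻¹ * systemConst p A B C lam

/-- The scale `W` of the target functional: its values are at most `√7 W`. -/
noncomputable def outputScale [Fact (1 ≤ p)] (μ : Measure (ParamSpace p d))
    (A : SeqSpace q →L[ℝ] SeqSpace q) (B : SeqSpace q) (C : Vec d →L[ℝ] SeqSpace q)
    (L s₀ M lam : ℝ) : ℝ :=
  activationScale L s₀ * argScale p.toReal A B C M lam * (barronMoment₂ μ).toReal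

/-- The gain `(‖C^E‖ + ‖B^E‖) / (1 - ‖A^E‖) · ‖K^{-⊤} Λ‖` of `constHESN`. -/
noncomputable def ESN.transferGain [NeZero d] (E : ESN N d) (lam : ℝ) : ℝ :=
  (‖E.C‖ + ‖E.B‖) / (1 - ‖E.A‖) * ‖E.KinvTΛ lam‖

/-- The error, relative to `argScale`, made in the arguments of `σ₂` when the state of the target
system is replaced by the state of the network. -/
noncomputable def ESN.transferError [NeZero d] (E : ESN N d) (p lam : ℝ) : ℝ :=
  lam⁻¹ * lam ^ ((N : ℝ) / d)
    + E.transferGain lam * ((horizon N d : ℝ) ^ inclusionExponent p * ‖E.A‖ ^ (horizon N d - 1))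

theorem one_div_one_sub_le_transferGain [NeZero d] [NeZero N] {E : ESN N d} (hE : ‖E.A‖ < 1)
    (hK : IsUnit E.K) (lam : ℝ) : 1 / (1 - ‖E.A‖) ≤ E.transferGain lam := by
  rw [ESN.transferGain, div_mul_eq_mul_div]
  have hle := E.one_le_norm_KinvTΛ_mul_norm_C hK lam
  refine div_le_div_of_nonneg_right ?_ (sub_pos.2 hE).le
  linarith [mul_nonneg (norm_nonneg E.B) (norm_nonneg (E.KinvTΛ lam))]

theorem one_le_transferGain [NeZero d] [NeZero N] {E : ESN N d} (hE : ‖E.A‖ < 1) (hK : IsUnit E.K)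
    (lam : ℝ) : 1 ≤ E.transferGain lam :=
  ((one_le_div (sub_pos.2 hE)).2 (sub_le_self 1 (norm_nonneg _))).trans
    (one_div_one_sub_le_transferGain hE hK lam)

theorem norm_inv_smul_lt_one {F : Type*} [SeminormedAddCommGroup F] [NormedSpace ℝ F] {A : F}
    {lam : ℝ} (hlam : ‖A‖ < lam) : ‖lam⁻¹ • A‖ < 1 := by
  have hlam0 : 0 < lam := (norm_nonneg _).trans_lt hlam
  rwa [norm_smul, norm_inv, Real.norm_of_nonneg hlam0.le, inv_mul_lt_one₀ hlam0]

variable {A : SeqSpace q →L[ℝ] SeqSpace q} {B : SeqSpace q} {C : Vec d →L[ℝ] SeqSpace q}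
  {M lam : ℝ}

theorem one_le_systemConst {r : ℝ} : 1 ≤ systemConst r A B C lam := le_max_right _ _

theorem norm_div_le_systemConst {r : ℝ} :
    ‖C‖ / (1 - ‖lam⁻¹ • A‖ ^ r) ^ (1 / r) ≤ systemConst r A B C lam :=
  (le_max_left _ _).trans (le_max_left _ _)

theorem norm_B_div_le_systemConst {r : ℝ} : ‖B‖ / (1 - ‖A‖) ≤ systemConst r A B C lam :=
  (le_max_right _ _).trans (le_max_left _ _)

theorem norm_C_le_systemConst {r : ℝ} (hr : 0 < r) (hlam : ‖A‖ < lam) :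
    ‖C‖ ≤ systemConst r A B C lam := by
  have hpow : ‖lam⁻¹ • A‖ ^ r < 1 :=
    Real.rpow_lt_one (norm_nonneg _) (norm_inv_smul_lt_one hlam) hr
  have hroot : (1 - ‖lam⁻¹ • A‖ ^ r) ^ (1 / r) ≤ 1 :=
    Real.rpow_le_one (by linarith) (by linarith [Real.rpow_nonneg (norm_nonneg (lam⁻¹ • A)) r])
      (by positivity)
  refine le_trans ?_ norm_div_le_systemConst
  exact le_div_self (norm_nonneg _) (Real.rpow_pos_of_pos (by linarith) _) hroot

theorem one_le_max_mul_inv (M : ℝ) (hlam0 : 0 ≤ lam) (hlam : lam < 1) :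
    1 ≤ max M 1 * (1 - lam)⁻¹ :=
  one_le_mul_of_one_le_of_one_le (le_max_right _ _)
    ((one_le_inv₀ (by linarith)).2 (by linarith))

theorem systemConst_le_argScale {r : ℝ} (hlam0 : 0 ≤ lam) (hlam : lam < 1) :
    systemConst r A B C lam ≤ argScale r A B C M lam :=
  le_mul_of_one_le_left (zero_le_one.trans one_le_systemConst) (one_le_max_mul_inv M hlam0 hlam)

theorem one_le_argScale {r : ℝ} (hlam0 : 0 ≤ lam) (hlam : lam < 1) :
    1 ≤ argScale r A B C M lam :=
  one_le_systemConst.trans (systemConst_le_argScale hlam0 hlam)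

theorem le_argScale {r : ℝ} (hlam0 : 0 ≤ lam) (hlam : lam < 1) : M ≤ argScale r A B C M lam := by
  have hM : 0 ≤ max M 1 := zero_le_one.trans (le_max_right _ _)
  rw [argScale, mul_assoc]
  refine (le_max_left M 1).trans (le_mul_of_one_le_right hM ?_)
  exact one_le_mul_of_one_le_of_one_le ((one_le_inv₀ (by linarith)).2 (by linarith))
    one_le_systemConst

theorem norm_C_mul_div_le_argScale {r : ℝ} (hr : 0 < r) (hlam : ‖A‖ < lam)
    (hlam_one : lam < 1) : ‖C‖ * M / (1 - ‖A‖) ≤ argScale r A B C M lam := by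
  have hA_sub : 0 < 1 - ‖A‖ := by linarith
  have hscale : M * (1 - ‖A‖)⁻¹ ≤ max M 1 * (1 - lam)⁻¹ :=
    mul_le_mul (le_max_left M 1) (by gcongr) (by positivity) (by positivity)
  rw [argScale, div_eq_mul_inv, mul_comm ‖C‖, mul_right_comm]
  exact mul_le_mul hscale (norm_C_le_systemConst hr hlam) (norm_nonneg C) (by positivity)

theorem transferError_nonneg [NeZero d] {E : ESN N d} (hE : ‖E.A‖ < 1) (p : ℝ) (hlam : 0 ≤ lam) :
    0 ≤ E.transferError p lam := by
  have : 0 < 1 - ‖E.A‖ := sub_pos.2 hE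
  unfold ESN.transferError ESN.transferGain
  positivity

theorem outputScale_nonneg [Fact (1 ≤ p)] {μ : Measure (ParamSpace p d)} {L s₀ : ℝ}
    (hlam0 : 0 ≤ lam) (hlam : lam < 1) : 0 ≤ outputScale μ A B C L s₀ M lam := by
  have hG : 1 ≤ argScale p.toReal A B C M lam := one_le_argScale hlam0 hlam
  have hS := activationScale_pos L s₀
  unfold outputScale
  positivity

theorem mul_outputScale_le_constHESN [NeZero d] [Fact (1 ≤ p)]
    (hpq : p.toReal.HolderConjugate q.toReal) (E : ESN N d) (hE : ‖E.A‖ < 1)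
    (μ : Measure (ParamSpace p d)) (L s₀ : ℝ) (hlam0 : 0 < lam) (hlam : lam < 1) :
    √8 * lam⁻¹ * dimFactor d p.toReal * outputScale μ A B C L s₀ M lam
        * (1 + E.transferGain lam)
      ≤ constHESN E μ A B C L s₀ M lam := by
  have hS := activationScale_pos L s₀
  have hM : max M 1 ≤ max M 1 ^ 2 := le_self_pow₀ (le_max_right _ _) two_ne_zero
  have hΘ : 1 ≤ systemConst p.toReal A B C lam := one_le_systemConst
  have hq : 1 ≤ (1 - lam ^ q.toReal) ^ (-(1 / q.toReal)) := by
    have hq0 : 0 < q.toReal := hpq.symm.pos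
    have hpow := Real.rpow_lt_one hlam0.le hlam hq0
    exact Real.one_le_rpow_of_pos_of_le_one_of_nonpos (by linarith)
      (by linarith [Real.rpow_nonneg hlam0.le q.toReal]) (neg_nonpos.2 (by positivity))
  have hD0 : 0 ≤ dimFactor d p.toReal := Real.rpow_nonneg (Nat.cast_nonneg d) _
  have hΓ : 0 ≤ E.transferGain lam := by
    unfold ESN.transferGain
    positivity
  calc √8 * lam⁻¹ * dimFactor d p.toReal * outputScale μ A B C L s₀ M lam
        * (1 + E.transferGain lam)
      = √8 * activationScale L s₀ * dimFactor d p.toReal * (1 - lam)⁻¹ * 1 * lam⁻¹ * max M 1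
          * systemConst p.toReal A B C lam * (barronMoment₂ μ).toReal
          * (1 + E.transferGain lam) := by
        rw [outputScale, argScale]
        ring
    _ ≤ √8 * activationScale L s₀ * dimFactor d p.toReal * (1 - lam)⁻¹
          * (1 - lam ^ q.toReal) ^ (-(1 / q.toReal)) * lam⁻¹ * max M 1 ^ 2
          * systemConst p.toReal A B C lam
          * max (barronMoment μ).toReal (barronMoment₂ μ).toReal
          * (1 + E.transferGain lam) := by
        gcongr
        exact le_max_right _ _
    _ = constHESN E μ A B C L s₀ M lam := by
        rw [constHESN, cTilde, ← dimFactor_eq d hpq, Real.sqrt_eq_rpow, activationScale,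
          systemConst, ESN.transferGain]
        ring

end Constants

section Arguments

variable {p q : ℝ≥0∞} [Fact (1 ≤ p)] [Fact (1 ≤ q)] [ENNReal.HolderConjugate p q] {N d : ℕ}
  {A : SeqSpace q →L[ℝ] SeqSpace q} {B : SeqSpace q} {C : Vec d →L[ℝ] SeqSpace q} {M lam r : ℝ}
  {z : InputSeq d} {x : ℕ → SeqSpace q}

theorem pow_horizon_le_rpow (hlam0 : 0 < lam) (hlam : lam < 1) :
    lam ^ horizon N d ≤ lam ^ ((N : ℝ) / d) := by
  rw [← Real.rpow_natCast]
  exact Real.rpow_le_rpow_of_exponent_ge hlam0 hlam.le (Nat.le_ceil _)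

theorem abs_targetArg_le (hr : 0 < r) (hlam : ‖A‖ < lam) (hlam_one : lam < 1)
    (hz : ∀ n, ‖z n‖ ≤ M) (hx : IsBoundedState A (fun n => C (z n) + B) x)
    (θ : ParamSpace p d) :
    |targetArg (x 1) (z 0) θ|
      ≤ argScale r A B C M lam * (2 * ‖θ.2.1‖ + ‖θ.2.2.1‖ + ‖θ.2.2.2‖) := by
  have hlam0 : 0 ≤ lam := (norm_nonneg A).trans hlam.le
  have hstate : ‖x 1‖ ≤ 2 * argScale r A B C M lam := by
    refine (hx.norm_le (hlam.trans hlam_one)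
      (fun n => norm_add_le_of_le (C.le_opNorm_of_le (hz n)) le_rfl) 1).trans ?_
    rw [add_div, two_mul]
    exact add_le_add (norm_C_mul_div_le_argScale hr hlam hlam_one)
      (norm_B_div_le_systemConst.trans (systemConst_le_argScale hlam0 hlam_one))
  have hinput : ‖z 0‖ ≤ argScale r A B C M lam := (hz 0).trans (le_argScale hlam0 hlam_one)
  have hG : 1 ≤ argScale r A B C M lam := one_le_argScale hlam0 hlam_one
  calc |targetArg (x 1) (z 0) θ|
      ≤ ‖θ.2.1‖ * ‖x 1‖ + ‖θ.2.2.1‖ * ‖z 0‖ + ‖θ.2.2.2‖ :=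
        (abs_add_three _ _ _).trans (add_le_add_three (abs_seqDot_le _ _)
          (abs_real_inner_le_norm _ _) le_rfl)
    _ ≤ ‖θ.2.1‖ * (2 * argScale r A B C M lam) + ‖θ.2.2.1‖ * argScale r A B C M lam
          + argScale r A B C M lam * ‖θ.2.2.2‖ := by
        gcongr
        exact le_mul_of_one_le_left (norm_nonneg _) hG
    _ = argScale r A B C M lam * (2 * ‖θ.2.1‖ + ‖θ.2.2.1‖ + ‖θ.2.2.2‖) := by ring

variable [NeZero d]

theorem pow_horizon_pred_le [NeZero N] {a : ℝ} (ha : 0 ≤ a) (hlam : a < lam) (hlam_one : lam < 1) :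
    a ^ (horizon N d - 1) ≤ lam⁻¹ * lam ^ ((N : ℝ) / d) := by
  have hlam0 : 0 < lam := ha.trans_lt hlam
  have hpred : lam ^ (horizon N d - 1) = lam⁻¹ * lam ^ horizon N d := by
    rw [pow_sub₀ _ hlam0.ne' horizon_pos, pow_one, mul_comm]
  calc a ^ (horizon N d - 1) ≤ lam ^ (horizon N d - 1) := by gcongr
    _ ≤ lam⁻¹ * lam ^ ((N : ℝ) / d) := by
        rw [hpred]
        gcongr
        exact pow_horizon_le_rpow hlam0 hlam_one

theorem norm_transferVec_le_systemConst (hr : 0 < r) (E : ESN N d) (hlam : ‖A‖ < lam)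
    (a : SeqSpace p) :
    ‖transferVec E A C lam a‖
      ≤ ‖E.KinvTΛ lam‖ * (‖a‖ * (systemConst r A B C lam
          * (horizon N d : ℝ) ^ inclusionExponent r)) := by
  have hsum : ‖C‖ * √(∑ k ∈ Finset.range (horizon N d), (‖lam⁻¹ • A‖ ^ k) ^ 2)
      ≤ systemConst r A B C lam * (horizon N d : ℝ) ^ inclusionExponent r := by
    calc ‖C‖ * √(∑ k ∈ Finset.range (horizon N d), (‖lam⁻¹ • A‖ ^ k) ^ 2)
        ≤ ‖C‖ * ((horizon N d : ℝ) ^ inclusionExponent r / (1 - ‖lam⁻¹ • A‖ ^ r) ^ (1 / r)) := by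
          gcongr
          exact sqrt_sum_pow_sq_le hr (norm_nonneg _) (norm_inv_smul_lt_one hlam) _
      _ = ‖C‖ / (1 - ‖lam⁻¹ • A‖ ^ r) ^ (1 / r) * (horizon N d : ℝ) ^ inclusionExponent r := by
          ring
      _ ≤ systemConst r A B C lam * (horizon N d : ℝ) ^ inclusionExponent r := by
          gcongr
          exact norm_div_le_systemConst
  refine (norm_transferVec_le E A C lam a le_mul_horizon).trans ?_
  rw [mul_assoc ‖a‖]
  gcongr ?_ * (?_ * ?_)

theorem mul_add_norm_div_mul_le_argScale {E : ESN N d} (hE : ‖E.A‖ < 1) (hlam0 : 0 ≤ lam)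
    (hlam : lam < 1) :
    (‖E.C‖ * M + ‖E.B‖) / (1 - ‖E.A‖) * ‖E.KinvTΛ lam‖ * systemConst r A B C lam
      ≤ argScale r A B C M lam * E.transferGain lam := by
  have hΘ : 1 ≤ systemConst r A B C lam := one_le_systemConst
  have hscale := one_le_max_mul_inv M hlam0 hlam
  have hnum : ‖E.C‖ * M + ‖E.B‖ ≤ max M 1 * (1 - lam)⁻¹ * (‖E.C‖ + ‖E.B‖) := by
    have hM : M ≤ max M 1 * (1 - lam)⁻¹ :=
      (le_max_left M 1).trans (le_mul_of_one_le_right (zero_le_one.trans (le_max_right _ _))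
        ((one_le_inv₀ (by linarith)).2 (by linarith)))
    nlinarith [norm_nonneg E.C, norm_nonneg E.B]
  calc (‖E.C‖ * M + ‖E.B‖) / (1 - ‖E.A‖) * ‖E.KinvTΛ lam‖ * systemConst r A B C lam
      ≤ max M 1 * (1 - lam)⁻¹ * (‖E.C‖ + ‖E.B‖) / (1 - ‖E.A‖) * ‖E.KinvTΛ lam‖
          * systemConst r A B C lam := by gcongr
    _ = argScale r A B C M lam * E.transferGain lam := by
        rw [argScale, ESN.transferGain]
        ring

theorem abs_networkArg_psi_sub_targetArg_le_transferError [NeZero N] (hr : 0 < r) {E : ESN N d}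
    (hE : ‖E.A‖ < 1) (hK : IsUnit E.K) (hlam : ‖A‖ < lam) (hlam_one : lam < 1)
    (hz : ∀ n, ‖z n‖ ≤ M) (hx : IsBoundedState A (fun n => C (z n) + B) x) {y : ℕ → Vec N}
    (hy : IsBoundedState E.clmA (fun n => E.clmC (z n) + E.B) y) (θ : ParamSpace p d) :
    |networkArg (y 1) (z 0) (psi E A B C lam θ) - targetArg (x 1) (z 0) θ|
      ≤ argScale r A B C M lam * E.transferError r lam * ‖θ.2.1‖ := by
  have hlam0 : 0 < lam := (norm_nonneg A).trans_lt hlam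
  have hM : 0 ≤ M := (norm_nonneg _).trans (hz 0)
  have hA_sub : 0 < 1 - ‖A‖ := by linarith
  have hG := mul_add_norm_div_mul_le_argScale (A := A) (B := B) (C := C) (M := M) (r := r) hE
    hlam0.le hlam_one
  set u := (horizon N d : ℝ) ^ inclusionExponent r * ‖E.A‖ ^ (horizon N d - 1)
  refine (abs_networkArg_psi_sub_targetArg_le hE hK (hlam.trans hlam_one) hlam0.ne' hz hx hy
    θ).trans ?_
  calc ‖transferVec E A C lam θ.2.1‖
          * (‖E.A‖ ^ (horizon N d - 1) * ((‖E.C‖ * M + ‖E.B‖) / (1 - ‖E.A‖)))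
        + ‖θ.2.1‖ * (‖A‖ ^ (horizon N d - 1) * (‖C‖ * M / (1 - ‖A‖)))
      ≤ ‖E.KinvTΛ lam‖ * (‖θ.2.1‖ * (systemConst r A B C lam
            * (horizon N d : ℝ) ^ inclusionExponent r))
          * (‖E.A‖ ^ (horizon N d - 1) * ((‖E.C‖ * M + ‖E.B‖) / (1 - ‖E.A‖)))
        + ‖θ.2.1‖ * (lam⁻¹ * lam ^ ((N : ℝ) / d) * argScale r A B C M lam) := by
        gcongr
        · exact norm_transferVec_le_systemConst hr E hlam θ.2.1
        · exact pow_horizon_pred_le (norm_nonneg A) hlam hlam_one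
        · exact norm_C_mul_div_le_argScale hr hlam hlam_one
    _ = (‖E.C‖ * M + ‖E.B‖) / (1 - ‖E.A‖) * ‖E.KinvTΛ lam‖ * systemConst r A B C lam
            * (u * ‖θ.2.1‖)
          + argScale r A B C M lam * (lam⁻¹ * lam ^ ((N : ℝ) / d)) * ‖θ.2.1‖ := by ring
    _ ≤ argScale r A B C M lam * E.transferGain lam * (u * ‖θ.2.1‖)
          + argScale r A B C M lam * (lam⁻¹ * lam ^ ((N : ℝ) / d)) * ‖θ.2.1‖ := by gcongr
    _ = argScale r A B C M lam * E.transferError r lam * ‖θ.2.1‖ := by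
        rw [ESN.transferError]
        ring

end Arguments

section ErrorRate

variable {N d : ℕ}

/-- The statistical part `N^{-1/2} g^{1/2}` of the error, where `g` bounds the density
`dμ_{A,B,C} / dν`. -/
noncomputable def samplingRate (N : ℕ) (g : ℝ) : ℝ := 1 / (N : ℝ) ^ (1 / 2 : ℝ) * g ^ (1 / 2 : ℝ)

/-- The bracket in the error bound, with `s` in place of its last summand. -/
noncomputable def ESN.errorRate (E : ESN N d) (lam s : ℝ) : ℝ :=
  lam ^ ((N : ℝ) / d) + ‖E.A‖ ^ horizon N d + s

theorem samplingRate_nonneg {g : ℝ} (hg : 0 ≤ g) : 0 ≤ samplingRate N g := by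
  unfold samplingRate
  positivity

theorem samplingRate_sq {g : ℝ} (hg : 0 ≤ g) : samplingRate N g ^ 2 = g / N := by
  rw [samplingRate, ← Real.sqrt_eq_rpow, ← Real.sqrt_eq_rpow, mul_pow, div_pow, one_pow,
    Real.sq_sqrt (Nat.cast_nonneg N), Real.sq_sqrt hg, one_div_mul_eq_div]

theorem one_div_sqrt_le_samplingRate {g : ℝ} (hg : 1 ≤ g) : 1 / √N ≤ samplingRate N g := by
  rw [samplingRate, ← Real.sqrt_eq_rpow]
  exact le_mul_of_one_le_right (by positivity) (Real.one_le_rpow hg (by norm_num))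

theorem rpow_half_le_add {v b s w : ℝ} (hb : 0 ≤ b) (hs : 0 ≤ s) (hw : 0 ≤ w)
    (h : v ≤ b ^ 2 + s ^ 2 * w ^ 2) : v ^ (1 / 2 : ℝ) ≤ b + s * w := by
  rw [← Real.sqrt_eq_rpow]
  refine Real.sqrt_le_iff.2 ⟨by positivity, h.trans ?_⟩
  linarith [mul_nonneg hb (mul_nonneg hs hw), add_sq b (s * w), mul_pow s w 2]

theorem add_mul_sqrt_seven_add_le {k l s Γ τ η : ℝ} (hk : 1 ≤ k) (hl : 0 ≤ l) (hs : 0 ≤ s)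
    (hΓ : 1 ≤ Γ) (hls : l + s ≤ τ) (hτ : (1 + Γ) * τ ≤ 1) (hη : η ≤ k * (l + 2 * Γ * τ)) :
    η + s * (√7 + η) ≤ √8 * k * (1 + Γ) * τ := by
  have hτ0 : 0 ≤ τ := by linarith
  have hs_half : s ≤ 1 / 2 := by linarith [mul_le_mul_of_nonneg_right hΓ hτ0]
  have h7_lower : 2 ≤ √7 := Real.le_sqrt_of_sq_le (by norm_num)
  have h7_upper : √7 ≤ 265 / 100 := Real.sqrt_le_iff.2 (by norm_num)
  have h8 : 2826 / 1000 ≤ √8 := Real.le_sqrt_of_sq_le (by norm_num)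
  have hdirect : (1 + s) * l + √7 * s ≤ √7 * τ := by
    have hl' : (1 + s) * l ≤ (1 + s) * (τ - s) := by gcongr; linarith
    linarith [mul_nonneg (sub_nonneg.2 (show s ≤ τ by linarith))
      (show 0 ≤ √7 - 1 - s by linarith)]
  have hcross : s * (2 * Γ * τ) ≤ (1 + Γ) * τ / 2 := by
    have hsΓ : s * (1 + Γ) ≤ 1 :=
      (mul_le_mul_of_nonneg_right (show s ≤ τ by linarith) (by linarith)).trans (by linarith)
    have hAMGM : 4 * Γ ≤ (1 + Γ) ^ 2 := by linarith [sq_nonneg (1 - Γ)]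
    calc s * (2 * Γ * τ) = s * (4 * Γ) * (τ / 2) := by ring
      _ ≤ s * (1 + Γ) ^ 2 * (τ / 2) := by gcongr
      _ = s * (1 + Γ) * ((1 + Γ) * τ / 2) := by ring
      _ ≤ (1 + Γ) * τ / 2 := mul_le_of_le_one_left (by positivity) hsΓ
  have hsum : (1 + s) * (l + 2 * Γ * τ) + √7 * s ≤ √8 * ((1 + Γ) * τ) := by
    calc (1 + s) * (l + 2 * Γ * τ) + √7 * s
        = ((1 + s) * l + √7 * s) + 2 * Γ * τ + s * (2 * Γ * τ) := by ring
      _ ≤ √7 * τ + 2 * Γ * τ + (1 + Γ) * τ / 2 := by gcongr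
      _ = (√7 + 2 * Γ + (1 + Γ) / 2) * τ := by ring
      _ ≤ (2826 / 1000 * (1 + Γ)) * τ := by gcongr; linarith
      _ ≤ √8 * ((1 + Γ) * τ) := by rw [mul_assoc]; gcongr
  calc η + s * (√7 + η) = (1 + s) * η + √7 * s * 1 := by ring
    _ ≤ (1 + s) * (k * (l + 2 * Γ * τ)) + √7 * s * k := by gcongr
    _ = k * ((1 + s) * (l + 2 * Γ * τ) + √7 * s) := by ring
    _ ≤ k * (√8 * ((1 + Γ) * τ)) := by gcongr
    _ = √8 * k * (1 + Γ) * τ := by ring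

variable {E : ESN N d} {p lam s : ℝ}

theorem errorRate_nonneg (hlam0 : 0 ≤ lam) (hs : 0 ≤ s) : 0 ≤ E.errorRate lam s := by
  unfold ESN.errorRate
  positivity

variable [NeZero d] [NeZero N]

theorem rpow_mul_pow_pred_le_errorRate (hp : 0 < p) (hE : ‖E.A‖ < 1) (hK : IsUnit E.K)
    (hlam0 : 0 < lam) (hlam_one : lam < 1) (hs : 1 / √N ≤ s)
    (hsmall : (1 + E.transferGain lam) * E.errorRate lam s * dimFactor d p ≤ 1) :
    (horizon N d : ℝ) ^ inclusionExponent p * ‖E.A‖ ^ (horizon N d - 1)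
      ≤ 2 * dimFactor d p * (lam⁻¹ * E.errorRate lam s) := by
  have hN : 0 < √(N : ℝ) := Real.sqrt_pos.2 (Nat.cast_pos.2 (NeZero.pos N))
  have hD : 1 ≤ dimFactor d p := one_le_dimFactor hp
  have hΓ : 1 ≤ E.transferGain lam := one_le_transferGain hE hK lam
  have hrate : 1 / √N ≤ E.errorRate lam s :=
    hs.trans (le_add_of_nonneg_left (by positivity))
  have hΓD : E.transferGain lam * dimFactor d p ≤ √N := by
    rw [← div_le_one hN]
    calc E.transferGain lam * dimFactor d p / √N
        = E.transferGain lam * (1 / √N) * dimFactor d p := by ring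
      _ ≤ (1 + E.transferGain lam) * E.errorRate lam s * dimFactor d p := by
          gcongr
          linarith
      _ ≤ 1 := hsmall
  have hγ : 2 * inclusionExponent p ≤ 1 / (2 * p) + 2 * inclusionExponent p :=
    le_add_of_nonneg_left (by positivity)
  refine (rpow_mul_pow_pred_le (inclusionExponent_nonneg p) (inclusionExponent_le_half hp)
    (norm_nonneg _) hE (NeZero.pos d) (NeZero.pos N) (sqrt_le_dimFactor_sq d p)
    (rpow_le_dimFactor hγ) le_mul_horizon (one_div_one_sub_le_transferGain hE hK lam)
    hΓD).trans ?_
  gcongr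
  calc ‖E.A‖ ^ (horizon N d - 1) + 1 / √N
      ≤ lam⁻¹ * (lam ^ horizon N d + ‖E.A‖ ^ horizon N d) + lam⁻¹ * s := by
        gcongr
        · exact pow_pred_le_inv_mul_add (norm_nonneg _) hlam0 horizon_pos
        · exact hs.trans (le_mul_of_one_le_left (le_trans (by positivity) hs)
            ((one_le_inv₀ hlam0).2 hlam_one.le))
    _ ≤ lam⁻¹ * (lam ^ ((N : ℝ) / d) + ‖E.A‖ ^ horizon N d) + lam⁻¹ * s := by
        gcongr
        exact pow_horizon_le_rpow hlam0 hlam_one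
    _ = lam⁻¹ * E.errorRate lam s := by
        rw [ESN.errorRate]
        ring

theorem transferError_le (hp : 0 < p) (hE : ‖E.A‖ < 1) (hK : IsUnit E.K)
    (hlam0 : 0 < lam) (hlam_one : lam < 1) (hs : 1 / √N ≤ s)
    (hsmall : (1 + E.transferGain lam) * E.errorRate lam s * dimFactor d p ≤ 1) :
    E.transferError p lam ≤ lam⁻¹ * dimFactor d p
      * (lam ^ ((N : ℝ) / d) + 2 * E.transferGain lam * E.errorRate lam s) := by
  have hD : 1 ≤ dimFactor d p := one_le_dimFactor hp
  have hΓ : 1 ≤ E.transferGain lam := one_le_transferGain hE hK lam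
  calc E.transferError p lam
      ≤ lam⁻¹ * 1 * lam ^ ((N : ℝ) / d)
        + E.transferGain lam * (2 * dimFactor d p * (lam⁻¹ * E.errorRate lam s)) := by
        rw [ESN.transferError, mul_one]
        gcongr _ + _ * ?_
        exact rpow_mul_pow_pred_le_errorRate hp hE hK hlam0 hlam_one hs hsmall
    _ ≤ lam⁻¹ * dimFactor d p * lam ^ ((N : ℝ) / d)
        + E.transferGain lam * (2 * dimFactor d p * (lam⁻¹ * E.errorRate lam s)) := by
        gcongr
    _ = lam⁻¹ * dimFactor d p
        * (lam ^ ((N : ℝ) / d) + 2 * E.transferGain lam * E.errorRate lam s) := by ring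

theorem transferError_add_samplingError_le (hp : 0 < p) (hE : ‖E.A‖ < 1) (hK : IsUnit E.K)
    (hlam0 : 0 < lam) (hlam_one : lam < 1) (hs : 1 / √N ≤ s)
    (hsmall : (1 + E.transferGain lam) * E.errorRate lam s * dimFactor d p ≤ 1) :
    E.transferError p lam + s * (√7 + E.transferError p lam)
      ≤ √8 * (lam⁻¹ * dimFactor d p) * (1 + E.transferGain lam) * E.errorRate lam s := by
  have hs0 : 0 ≤ s := le_trans (by positivity) hs
  have hD : 1 ≤ dimFactor d p := one_le_dimFactor hp
  have hΓ : 1 ≤ E.transferGain lam := one_le_transferGain hE hK lam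
  have hτ : 0 ≤ E.errorRate lam s := errorRate_nonneg hlam0.le hs0
  refine add_mul_sqrt_seven_add_le
    (one_le_mul_of_one_le_of_one_le ((one_le_inv₀ hlam0).2 hlam_one.le) hD)
    (Real.rpow_nonneg hlam0.le _) hs0 hΓ ?_ ?_
    (transferError_le hp hE hK hlam0 hlam_one hs hsmall)
  · rw [ESN.errorRate]
    linarith [pow_nonneg (norm_nonneg E.A) (horizon N d)]
  · exact (le_mul_of_one_le_right (by positivity) hD).trans hsmall

end ErrorRate

section SamplingError

variable {p : ℝ≥0∞} [Fact (1 ≤ p)] {d N : ℕ} {μ : Measure (ParamSpace p d)} {X Ω : Type*}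
  [MeasurableSpace X] [MeasurableSpace Ω] {ψ : ParamSpace p d → X} {h : X → ℝ}
  {h₀ : ParamSpace p d → ℝ} {b c : ℝ}

theorem memLp_map_of_abs_le_paramSize (hμ : barronMoment₂ μ < ∞) (hψ : Measurable ψ)
    (hm : Measurable h) (hle : ∀ θ, |h (ψ θ)| ≤ c * paramSize θ) : MemLp h 2 (μ.map ψ) :=
  (memLp_map_measure_iff hm.aestronglyMeasurable hψ.aemeasurable).2
    (memLp_of_abs_le_paramSize hμ (hm.comp hψ) hle)

theorem integral_sq_map_le_of_abs_le_paramSize (hμ : barronMoment₂ μ < ∞) (hψ : Measurable ψ)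
    (hm : Measurable h) (hle : ∀ θ, |h (ψ θ)| ≤ c * paramSize θ) :
    ∫ x, h x ^ 2 ∂μ.map ψ ≤ (c * (barronMoment₂ μ).toReal) ^ 2 := by
  rw [integral_map hψ.aemeasurable (hm.pow_const 2).aestronglyMeasurable]
  exact integral_sq_le_of_abs_le_paramSize hμ (hm.comp hψ) hle

variable [IsProbabilityMeasure μ]

theorem abs_integral_sub_integral_map_le (hμ : barronMoment₂ μ < ∞) (hψ : Measurable ψ)
    (hm : Measurable h) (hm₀ : Measurable h₀) (hb : 0 ≤ b)
    (hle : ∀ θ, |h (ψ θ)| ≤ c * paramSize θ)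
    (hsub : ∀ θ, |h (ψ θ) - h₀ θ| ≤ b * paramSize θ) :
    |∫ θ, h₀ θ ∂μ - ∫ x, h x ∂μ.map ψ| ≤ b * (barronMoment₂ μ).toReal := by
  have hint : Integrable (fun θ => h (ψ θ)) μ :=
    (memLp_of_abs_le_paramSize hμ (hm.comp hψ) hle).integrable one_le_two
  have hint_sub : Integrable (fun θ => h (ψ θ) - h₀ θ) μ :=
    (memLp_of_abs_le_paramSize hμ ((hm.comp hψ).sub hm₀) hsub).integrable one_le_two
  have hint₀ : Integrable h₀ μ :=
    (hint.sub hint_sub).congr (ae_of_all _ fun θ => sub_sub_cancel (h (ψ θ)) (h₀ θ))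
  rw [abs_sub_comm, integral_map hψ.aemeasurable hm.aestronglyMeasurable,
    ← integral_sub hint hint₀]
  exact abs_integral_le_of_abs_le_paramSize hμ ((hm.comp hψ).sub hm₀) hb hsub

theorem rpow_integral_sq_sub_importanceMean_le [NeZero N] {ν : Measure X} [IsProbabilityMeasure ν]
    {P : Measure Ω} [IsProbabilityMeasure P] {θ : Fin N → Ω → X} (hμ : barronMoment₂ μ < ∞)
    (hψ : Measurable ψ) (hm : Measurable h) (hm₀ : Measurable h₀) (hb : 0 ≤ b) (hc : 0 ≤ c)
    (hle : ∀ θ, |h (ψ θ)| ≤ c * paramSize θ) (hsub : ∀ θ, |h (ψ θ) - h₀ θ| ≤ b * paramSize θ)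
    (hac : μ.map ψ ≪ ν) (hbdd : essSup ((μ.map ψ).rnDeriv ν) ν < ∞)
    (hlaw : ∀ i, MeasurePreserving (θ i) P ν)
    (hindep : Pairwise fun i j => IndepFun (θ i) (θ j) P) :
    (∫ ω, (∫ θ, h₀ θ ∂μ - importanceMean (μ.map ψ) ν h fun i => θ i ω) ^ 2 ∂P) ^ (1 / 2 : ℝ)
      ≤ b * (barronMoment₂ μ).toReal
        + samplingRate N (essSup ((μ.map ψ).rnDeriv ν) ν).toReal
          * (c * (barronMoment₂ μ).toReal) := by
  have hJ : 0 ≤ (barronMoment₂ μ).toReal := ENNReal.toReal_nonneg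
  have hg : 0 ≤ (essSup ((μ.map ψ).rnDeriv ν) ν).toReal := ENNReal.toReal_nonneg
  refine rpow_half_le_add (mul_nonneg hb hJ) (samplingRate_nonneg hg) (mul_nonneg hc hJ) ?_
  refine (integral_sq_sub_importanceMean_le hac hbdd hm
    (memLp_map_of_abs_le_paramSize hμ hψ hm hle) hlaw hindep _).trans ?_
  rw [samplingRate_sq hg]
  gcongr ?_ + _ * ?_
  · exact sq_le_sq' (neg_le_of_abs_le (abs_integral_sub_integral_map_le hμ hψ hm hm₀ hb hle hsub))
      (le_of_abs_le (abs_integral_sub_integral_map_le hμ hψ hm hm₀ hb hle hsub))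
  · exact integral_sq_map_le_of_abs_le_paramSize hμ hψ hm hle

end SamplingError

section Functional

variable {p q : ℝ≥0∞} [Fact (1 ≤ p)] [Fact (1 ≤ q)] [ENNReal.HolderConjugate p q] {N d : ℕ}
  {A : SeqSpace q →L[ℝ] SeqSpace q} {B : SeqSpace q} {C : Vec d →L[ℝ] SeqSpace q} {M lam : ℝ}
  {z : InputSeq d} {x : ℕ → SeqSpace q} {μ : Measure (ParamSpace p d)} {σ : ℝ → ℝ} {L : ℝ≥0}

/-- The readout which turns the output of the extreme learning machine into the importance
sampling estimator of an integral with respect to `κ`. -/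
noncomputable def importanceReadout (κ ν : Measure (FinParamSpace N d))
    (ϑ : Fin N → FinParamSpace N d) (i : Fin N) : ℝ :=
  (N : ℝ)⁻¹ * ((κ.rnDeriv ν (ϑ i)).toReal * (ϑ i).1)

theorem measurable_importanceReadout (κ ν : Measure (FinParamSpace N d)) :
    Measurable (importanceReadout κ ν) := by
  unfold importanceReadout
  fun_prop

theorem elmOutput_importanceReadout (κ ν : Measure (FinParamSpace N d))
    (ϑ : Fin N → FinParamSpace N d) (y : Vec N) (z₀ : Vec d) :
    elmOutput σ (importanceReadout κ ν ϑ) ϑ y z₀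
      = importanceMean κ ν (fun ϑ => ϑ.1 * σ (networkArg y z₀ ϑ)) ϑ := by
  simp only [elmOutput, importanceReadout, importanceMean, networkArg, Finset.mul_sum, mul_assoc]

theorem measurable_mul_activation_targetArg (hσ : LipschitzWith L σ) (x₁ : SeqSpace q)
    (z₀ : Vec d) : Measurable fun θ : ParamSpace p d => θ.1 * σ (targetArg x₁ z₀ θ) :=
  measurable_fst.mul (hσ.continuous.measurable.comp (measurable_targetArg _ _))

theorem measurable_mul_activation_networkArg (hσ : LipschitzWith L σ) (y₁ : Vec N) (z₀ : Vec d) :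
    Measurable fun ϑ : FinParamSpace N d => ϑ.1 * σ (networkArg y₁ z₀ ϑ) :=
  measurable_fst.mul (hσ.continuous.measurable.comp (measurable_networkArg _ _))

variable [IsProbabilityMeasure μ]

theorem abs_integral_mul_activation_le (hp : 0 < p.toReal) (hμ : barronMoment₂ μ < ∞)
    (hσ : LipschitzWith L σ) (hlam : ‖A‖ < lam) (hlam_one : lam < 1) (hz : ∀ n, ‖z n‖ ≤ M)
    (hx : IsBoundedState A (fun n => C (z n) + B) x) :
    |∫ θ, θ.1 * σ (targetArg (x 1) (z 0) θ) ∂μ|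
      ≤ √7 * outputScale μ A B C L (σ 0) M lam := by
  have hG : 1 ≤ argScale p.toReal A B C M lam :=
    one_le_argScale ((norm_nonneg A).trans hlam.le) hlam_one
  have hS := activationScale_pos L (σ 0)
  refine (abs_integral_le_of_abs_le_paramSize hμ (measurable_mul_activation_targetArg hσ _ _)
    (by positivity) fun θ => abs_mul_activation_le hσ hG le_rfl ?_).trans_eq ?_
  · rw [add_zero]
    exact abs_targetArg_le hp hlam hlam_one hz hx θ
  · rw [outputScale]
    ring

variable [NeZero d] [NeZero N] {E : ESN N d} {y : ℕ → Vec N} {ν : Measure (FinParamSpace N d)}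
  [IsProbabilityMeasure ν] {Ω : Type*} [MeasurableSpace Ω] {P : Measure Ω}
  [IsProbabilityMeasure P] {θ : Fin N → Ω → FinParamSpace N d}

theorem rpow_integral_sq_sub_elmOutput_le (hp : 0 < p.toReal) (hμ : barronMoment₂ μ < ∞)
    (hσ : LipschitzWith L σ) (hE : ‖E.A‖ < 1) (hK : IsUnit E.K) (hlam : ‖A‖ < lam)
    (hlam_one : lam < 1) (hz : ∀ n, ‖z n‖ ≤ M)
    (hx : IsBoundedState A (fun n => C (z n) + B) x)
    (hy : IsBoundedState E.clmA (fun n => E.clmC (z n) + E.B) y)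
    (hac : muABC E μ A B C lam ≪ ν) (hbdd : essSup ((muABC E μ A B C lam).rnDeriv ν) ν < ∞)
    (hlaw : ∀ i, MeasurePreserving (θ i) P ν)
    (hindep : Pairwise fun i j => IndepFun (θ i) (θ j) P) :
    Integrable (fun ω => |∫ θ, θ.1 * σ (targetArg (x 1) (z 0) θ) ∂μ
        - elmOutput σ (importanceReadout (muABC E μ A B C lam) ν fun i => θ i ω)
          (fun i => θ i ω) (y 1) (z 0)| ^ 2) P ∧
    (∫ ω, |∫ θ, θ.1 * σ (targetArg (x 1) (z 0) θ) ∂μ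
        - elmOutput σ (importanceReadout (muABC E μ A B C lam) ν fun i => θ i ω)
          (fun i => θ i ω) (y 1) (z 0)| ^ 2 ∂P) ^ (1 / 2 : ℝ)
      ≤ outputScale μ A B C L (σ 0) M lam * (E.transferError p.toReal lam
        + samplingRate N (essSup ((muABC E μ A B C lam).rnDeriv ν) ν).toReal
          * (√7 + E.transferError p.toReal lam)) := by
  have hlam0 : 0 ≤ lam := (norm_nonneg A).trans hlam.le
  have hψ := measurable_psi (p := p) E A B C lam
  have hprob : IsProbabilityMeasure (muABC E μ A B C lam) :=
    Measure.isProbabilityMeasure_map hψ.aemeasurable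
  have hS := activationScale_pos L (σ 0)
  have hG : 1 ≤ argScale p.toReal A B C M lam := one_le_argScale hlam0 hlam_one
  have hη : 0 ≤ E.transferError p.toReal lam := transferError_nonneg hE _ hlam0
  have hm := measurable_mul_activation_networkArg hσ (y 1) (z 0)
  have harg := fun θ : ParamSpace p d =>
    abs_networkArg_psi_sub_targetArg_le_transferError hp hE hK hlam hlam_one hz hx hy θ
  have hsub := fun θ => abs_mul_activation_sub_le hσ (zero_le_one.trans hG) hη (harg θ)
  have hle := fun θ : ParamSpace p d => abs_mul_activation_le (θ := θ)
    (t := networkArg (y 1) (z 0) (psi E A B C lam θ)) hσ hG hη (by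
      linarith [abs_targetArg_le hp hlam hlam_one hz hx θ, harg θ,
        abs_sub_abs_le_abs_sub (networkArg (y 1) (z 0) (psi E A B C lam θ))
          (targetArg (x 1) (z 0) θ)])
  simp only [elmOutput_importanceReadout, sq_abs]
  constructor
  · exact ((memLp_const _).sub (memLp_importanceMean hac hbdd hm
      (memLp_map_of_abs_le_paramSize hμ hψ hm hle) hlaw)).integrable_sq
  · refine (rpow_integral_sq_sub_importanceMean_le hμ hψ hm
      (measurable_mul_activation_targetArg hσ _ _) (by positivity) (by positivity) hle hsub hac
      hbdd hlaw hindep).trans_eq ?_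
    rw [outputScale, muABC]
    ring

end Functional

section Dichotomy

variable {p q : ℝ≥0∞} [Fact (1 ≤ p)] [Fact (1 ≤ q)] {N d : ℕ} {E : ESN N d}
  {A : SeqSpace q →L[ℝ] SeqSpace q} {B : SeqSpace q} {C : Vec d →L[ℝ] SeqSpace q}
  {M lam s L s₀ : ℝ} {μ : Measure (ParamSpace p d)}

theorem rpow_integral_sq_sub_elmOutput_zero_le {Ω : Type*} [MeasurableSpace Ω] (P : Measure Ω)
    [IsProbabilityMeasure P] (σ : ℝ → ℝ) (θ : Fin N → Ω → FinParamSpace N d) (y : Vec N)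
    (z₀ : Vec d) {t c : ℝ} (ht : |t| ≤ c) :
    Integrable (fun ω => |t - elmOutput σ 0 (fun i => θ i ω) y z₀| ^ 2) P ∧
    (∫ ω, |t - elmOutput σ 0 (fun i => θ i ω) y z₀| ^ 2 ∂P) ^ (1 / 2 : ℝ) ≤ c := by
  simp only [elmOutput, Pi.zero_apply, zero_mul, Finset.sum_const_zero, sub_zero]
  refine ⟨integrable_const _, ?_⟩
  rwa [integral_const, probReal_univ, one_smul, ← Real.sqrt_eq_rpow,
    Real.sqrt_sq (abs_nonneg t)]

variable [NeZero d]

theorem sqrt_seven_mul_outputScale_le (hpq : p.toReal.HolderConjugate q.toReal) (hE : ‖E.A‖ < 1)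
    (hlam0 : 0 < lam) (hlam_one : lam < 1) (hs : 0 ≤ s)
    (hlarge : 1 ≤ (1 + E.transferGain lam) * E.errorRate lam s * dimFactor d p.toReal) :
    √7 * outputScale μ A B C L s₀ M lam
      ≤ constHESN E μ A B C L s₀ M lam * E.errorRate lam s := by
  have hW : 0 ≤ outputScale μ A B C L s₀ M lam := outputScale_nonneg hlam0.le hlam_one
  have hτ : 0 ≤ E.errorRate lam s := errorRate_nonneg hlam0.le hs
  calc √7 * outputScale μ A B C L s₀ M lam
      ≤ √8 * outputScale μ A B C L s₀ M lam := by
        gcongr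
        norm_num
    _ ≤ √8 * outputScale μ A B C L s₀ M lam * (lam⁻¹
          * ((1 + E.transferGain lam) * E.errorRate lam s * dimFactor d p.toReal)) :=
        le_mul_of_one_le_right (by positivity)
          (one_le_mul_of_one_le_of_one_le ((one_le_inv₀ hlam0).2 hlam_one.le) hlarge)
    _ = √8 * lam⁻¹ * dimFactor d p.toReal * outputScale μ A B C L s₀ M lam
          * (1 + E.transferGain lam) * E.errorRate lam s := by ring
    _ ≤ constHESN E μ A B C L s₀ M lam * E.errorRate lam s := by
        gcongr
        exact mul_outputScale_le_constHESN hpq E hE μ L s₀ hlam0 hlam_one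

theorem outputScale_mul_le [NeZero N] (hpq : p.toReal.HolderConjugate q.toReal) (hE : ‖E.A‖ < 1)
    (hK : IsUnit E.K) (hlam0 : 0 < lam) (hlam_one : lam < 1) (hs : 1 / √N ≤ s)
    (hsmall : (1 + E.transferGain lam) * E.errorRate lam s * dimFactor d p.toReal ≤ 1) :
    outputScale μ A B C L s₀ M lam * (E.transferError p.toReal lam
        + s * (√7 + E.transferError p.toReal lam))
      ≤ constHESN E μ A B C L s₀ M lam * E.errorRate lam s := by
  have hW : 0 ≤ outputScale μ A B C L s₀ M lam := outputScale_nonneg hlam0.le hlam_one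
  have hτ : 0 ≤ E.errorRate lam s :=
    errorRate_nonneg hlam0.le ((by positivity : (0 : ℝ) ≤ 1 / √N).trans hs)
  calc outputScale μ A B C L s₀ M lam * (E.transferError p.toReal lam
        + s * (√7 + E.transferError p.toReal lam))
      ≤ outputScale μ A B C L s₀ M lam * (√8 * (lam⁻¹ * dimFactor d p.toReal)
          * (1 + E.transferGain lam) * E.errorRate lam s) := by
        gcongr
        exact transferError_add_samplingError_le hpq.pos hE hK hlam0 hlam_one hs hsmall
    _ = √8 * lam⁻¹ * dimFactor d p.toReal * outputScale μ A B C L s₀ M lam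
          * (1 + E.transferGain lam) * E.errorRate lam s := by ring
    _ ≤ constHESN E μ A B C L s₀ M lam * E.errorRate lam s := by
        gcongr
        exact mul_outputScale_le_constHESN hpq E hE μ L s₀ hlam0 hlam_one

end Dichotomy

theorem theorem3p6_general
    {p q : ℝ≥0∞} [Fact (1 ≤ p)] [Fact (1 ≤ q)] [ENNReal.HolderConjugate p q]
    (hp_one : 1 < p) (hp_top : p < ∞) {d N : ℕ} [NeZero d] [NeZero N]
    (σ₂ : ℝ → ℝ) (L : ℝ≥0) (hσ₂ : LipschitzWith L σ₂)
    (M : ℝ) (I : Set (InputSeq d)) (hI : ∀ z ∈ I, ∀ n, ‖z n‖ ≤ M)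
    (H : InputSeq d → ℝ) (μ : Measure (ParamSpace p d))
    (A : SeqSpace q →L[ℝ] SeqSpace q) (B : SeqSpace q) (C : Vec d →L[ℝ] SeqSpace q)
    (hH : IsBarronRealization id σ₂ I H μ A.toLinearMap B C.toLinearMap)
    (hμ : barronMoment₂ μ < ∞) (lam : ℝ) (hlam : ‖A‖ < lam) (hlam_one : lam < 1)
    (E : ESN N d) (hE : ‖E.A‖ < 1) (hK : IsUnit E.K)
    (ν : Measure (FinParamSpace N d)) [IsProbabilityMeasure ν]
    (hac : muABC E μ A B C lam ≪ ν)
    (hbdd : essSup ((muABC E μ A B C lam).rnDeriv ν) ν < ∞)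
    {Ω : Type*} [MeasurableSpace Ω] (P : Measure Ω) [IsProbabilityMeasure P]
    (θ : Fin N → Ω → FinParamSpace N d) (hlaw : ∀ i, MeasurePreserving (θ i) P ν)
    (hindep : Pairwise fun i j => IndepFun (θ i) (θ j) P) :
    ∃ f : (Fin N → FinParamSpace N d) → (Fin N → ℝ), Measurable f ∧
      ∀ z ∈ I, (∃! x : ℕ → Vec N, E.IsState id z x) ∧
        ∀ x : ℕ → Vec N, E.IsState id z x →
          Integrable (fun ω =>
            |H z - elmOutput σ₂ (f fun i => θ i ω) (fun i => θ i ω) (x 1) (z 0)| ^ 2) P ∧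
          (∫ ω, |H z - elmOutput σ₂ (f fun i => θ i ω) (fun i => θ i ω) (x 1) (z 0)| ^ 2 ∂P)
              ^ (1 / 2 : ℝ)
            ≤ constHESN E μ A B C L (σ₂ 0) M lam *
              (lam ^ ((N : ℝ) / d) + ‖E.A‖ ^ horizon N d
                + 1 / (N : ℝ) ^ (1 / 2 : ℝ)
                  * (essSup ((muABC E μ A B C lam).rnDeriv ν) ν).toReal ^ (1 / 2 : ℝ)) := by
  have hpq : p.toReal.HolderConjugate q.toReal := ENNReal.HolderConjugate.toReal
    (by simpa using (ENNReal.toReal_lt_toReal ENNReal.one_ne_top hp_top.ne).2 hp_one)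
  have hlam0 : 0 < lam := (norm_nonneg A).trans_lt hlam
  have hμprob : IsProbabilityMeasure μ := hH.isProbabilityMeasure
  have hκprob : IsProbabilityMeasure (muABC E μ A B C lam) :=
    Measure.isProbabilityMeasure_map (measurable_psi E A B C lam).aemeasurable
  have hs := one_div_sqrt_le_samplingRate (N := N)
    (ENNReal.toReal_mono hbdd.ne (one_le_essSup_rnDeriv hac))
  rcases le_total 1 ((1 + E.transferGain lam) * E.errorRate lam (samplingRate N
    (essSup ((muABC E μ A B C lam).rnDeriv ν) ν).toReal) * dimFactor d p.toReal)
    with hlarge | hsmall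
  · refine ⟨0, measurable_zero, fun z hz =>
      ⟨E.existsUnique_isState_id hE (hI z hz), fun y _ => ?_⟩⟩
    obtain ⟨x, hx, -⟩ := hH.existsUnique_state z hz
    rw [hH.repr z hz x hx]
    exact rpow_integral_sq_sub_elmOutput_zero_le P σ₂ θ (y 1) (z 0)
      ((abs_integral_mul_activation_le hpq.pos hμ hσ₂ hlam hlam_one (hI z hz)
        (isSeqState_id_iff.1 hx)).trans (sqrt_seven_mul_outputScale_le hpq hE hlam0 hlam_one
          (samplingRate_nonneg ENNReal.toReal_nonneg) hlarge))
  · refine ⟨importanceReadout (muABC E μ A B C lam) ν, measurable_importanceReadout _ _,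
      fun z hz => ⟨E.existsUnique_isState_id hE (hI z hz), fun y hy => ?_⟩⟩
    obtain ⟨x, hx, -⟩ := hH.existsUnique_state z hz
    rw [hH.repr z hz x hx]
    exact (rpow_integral_sq_sub_elmOutput_le hpq.pos hμ hσ₂ hE hK hlam hlam_one (hI z hz)
      (isSeqState_id_iff.1 hx) (E.isState_id_iff.1 hy) hac hbdd hlaw hindep).imp_right
      fun hle => hle.trans (outputScale_mul_le hpq hE hK hlam0 hlam_one hs hsmall)

theorem theorem3p6
    {p q : ℝ≥0∞} [Fact (1 ≤ p)] [Fact (1 ≤ q)] [ENNReal.HolderConjugate p q]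
    (hp_one : 1 < p) (hp_top : p < ∞)
    {d N : ℕ} [NeZero d] [NeZero N]
    -- the activation functions: `σ₁ = id`, and `σ₂` is Lipschitz
    (σ₂ : ℝ → ℝ) (L : ℝ≥0) (hσ₂ : LipschitzWith L σ₂)
    -- the bounded input set `D` and the inputs `I ⊆ D^{ℤ₋}`
    (D : Set (Vec d)) (M : ℝ) (hM : ∀ u ∈ D, ‖u‖ ≤ M)
    (I : Set (InputSeq d)) (hI : ∀ z ∈ I, ∀ n, z n ∈ D)
    -- the target functional and its realization
    (H : InputSeq d → ℝ) (μ : Measure (ParamSpace p d))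
    (A : SeqSpace q →L[ℝ] SeqSpace q) (B : SeqSpace q) (C : Vec d →L[ℝ] SeqSpace q)
    (hH : IsBarronRealization id σ₂ I H μ A.toLinearMap B C.toLinearMap)
    (hA : ‖A‖ < 1) (hμ : barronMoment₂ μ < ∞)
    (lam : ℝ) (hlam : ‖A‖ < lam) (hlam_one : lam < 1)
    -- the echo state network
    (E : ESN N d) (hE : ‖E.A‖ < 1) (hK : IsUnit E.K)
    -- the law of the weights of the extreme learning machine
    (ν : Measure (FinParamSpace N d)) [IsProbabilityMeasure ν]
    (hac : muABC E μ A B C lam ≪ ν)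
    (hbdd : essSup ((muABC E μ A B C lam).rnDeriv ν) ν < ∞)
    -- the i.i.d. weights
    {Ω : Type*} [MeasurableSpace Ω] (P : Measure Ω) [IsProbabilityMeasure P]
    (θ : Fin N → Ω → FinParamSpace N d) (hθ : ∀ i, Measurable (θ i))
    (hindep : iIndepFun θ P) (hlaw : ∀ i, P.map (θ i) = ν) :
    ∃ f : (Fin N → FinParamSpace N d) → (Fin N → ℝ), Measurable f ∧
      ∀ z ∈ I, (∃! x : ℕ → Vec N, E.IsState id z x) ∧
        ∀ x : ℕ → Vec N, E.IsState id z x →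
          Integrable (fun ω =>
            |H z - elmOutput σ₂ (f fun i => θ i ω) (fun i => θ i ω) (x 1) (z 0)| ^ 2) P ∧
          (∫ ω, |H z - elmOutput σ₂ (f fun i => θ i ω) (fun i => θ i ω) (x 1) (z 0)| ^ 2 ∂P)
              ^ (1 / 2 : ℝ)
            ≤ constHESN E μ A B C L (σ₂ 0) M lam *
              (lam ^ ((N : ℝ) / d) + ‖E.A‖ ^ horizon N d
                + 1 / (N : ℝ) ^ (1 / 2 : ℝ)
                  * (essSup ((muABC E μ A B C lam).rnDeriv ν) ν).toReal ^ (1 / 2 : ℝ)) := by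
  exact theorem3p6_general hp_one hp_top σ₂ L hσ₂ M I (fun z hz n => hM _ (hI z hz n)) H μ A B C hH
    hμ lam hlam hlam_one E hE hK ν hac hbdd P θ (fun i => ⟨hθ i, hlaw i⟩)
    fun i j hij => hindep.indepFun hij
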